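/- Write $C^0(\mathbb R^2)$ for the bounded continuous vector fields on $\mathbb R^2$ with the sup norm; let $\|f\|_{C^0}=\sup|f|$, and $\|f\|_{C^\alpha}=\sup|f|+\sup_{x\ne y}\frac{|f(x)-f(y)|}{|x-y|^\alpha}$ for $\alpha\in(0,1)$. For a drift $u\in L^1([0,1],C^0(\mathbb R^2))$, a path $W\in C^0([0,1],\mathbb R^2)$, $y\in\mathbb R^2$ and $\varepsilon\in(0,1]$, a Carathéodory solution on $[0,\varepsilon]$ of $$dX_t=u(t,X_t)\,dt+dW_t,\qquad X_0=y \qquad (*)$$ is a path $X\in C^0([0,\varepsilon],\mathbb R^2)$ with $X_t=y+\int_0^t u(s,X_s)\,ds+W_t-W_0$ for all $t\in[0,\varepsilon]$. If $W$ is random, path-by-path uniqueness on $[0,\varepsilon]$ means that for almost every realization of $W$ there is exactly one Carathéodory solution of $(*)$ on $[0,\varepsilon]$. **Corollary.** For every $\alpha\in[0,1/2)$ there exists a random velocity field $u:[0,1]\times\mathbb R^2\to\mathbb R^2$ (jointly measurable in the random parameter, $t$ and $x$, every realization lying in $L^1([0,1],C^0(\mathbb R^2))$) such that surely $\|u(t,\cdot)\|_{C^\alpha(\mathbb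 R^2)}\le 2$ for all $t\in[0,1]$, and: 1. For every $\beta$ with $\frac{1}{2(1-\alpha)}<\beta\le 1$, every deterministic $\beta$-Hölder path $W:[0,1]\to\mathbb R^2$ and every $y\in\mathbb R^2$, almost surely in $u$, the ODE $(*)$ has at least two distinct Carathéodory solutions on $[0,\varepsilon]$ for every $\varepsilon\in(0,1]$. 2. In particular, path-by-path uniqueness fails for fractional Brownian motion: for every $H\in(0,1)$ with $\alpha<1-\frac1{2H}$ and every $y\in\mathbb R^2$, almost surely in $u$, if $(*)$ is driven by an independent two-dimensional fractional Brownian motion with Hurst parameter $H$ (the continuous centered Gaussian process on $[0,1]$ with $\mathbb E[W_{t,i}W_{s,j}]=\frac12\delta_{ij}(t^{2H}+s^{2H}-|t-s|^{2H})$), then path-by-path uniqueness does not hold on $[0,\varepsilon]$ for any $\varepsilon\in(0,1]$. -/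

import Mathlib

open MeasureTheory ProbabilityTheory Set
open scoped NNReal ENNReal BoundedContinuousFunction

noncomputable section

/-- Euclidean space `ℝᵈ` with the Euclidean norm. -/
abbrev Space (d : ℕ) : Type := EuclideanSpace ℝ (Fin d)

/-- The path space `C⁰([0,T], ℝᵈ)`. -/
abbrev Path0 (d : ℕ) (T : ℝ≥0) : Type := C(Icc (0 : ℝ) T, Space d)

/-- Path space carries the Borel σ-algebra of the uniform topology. -/
instance instMeasurableSpacePath0 (d : ℕ) (T : ℝ≥0) : MeasurableSpace (Path0 d T) := borel _

instance instBorelSpacePath0 (d : ℕ) (T : ℝ≥0) : BorelSpace (Path0 d T) := ⟨rfl⟩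

/-- The initial time `0`, as a point of `[0,T]`. -/
def startTime (T : ℝ≥0) : Icc (0 : ℝ) T := ⟨0, le_refl 0, T.2⟩

/-- The restriction map `C⁰([0,T], ℝᵈ) → C⁰([0,ε], ℝᵈ)`, for `ε ≤ T`. -/
def restrictPath {d : ℕ} {T ε : ℝ≥0} (h : ε ≤ T) (W : Path0 d T) : Path0 d ε :=
  W.comp ⟨inclusion (Icc_subset_Icc_right (NNReal.coe_le_coe.mpr h)), continuous_inclusion _⟩

/-- The usual Hölder norm `‖f‖_{C^α}`: the sup norm if `α = 0`, and the sup norm plus the `α`-Hölder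
seminorm if `α ∈ (0,1)`. It takes the value `∞` when `f` is not in the space. -/
def holderNorm {d : ℕ} (α : ℝ≥0) (f : Space d → Space d) : ℝ≥0∞ :=
  (⨆ x, ‖f x‖ₑ) + if α = 0 then 0 else eHolderNorm α f

/-- `u ∈ L¹([0,T], C⁰(ℝᵈ))`, where `C⁰(ℝᵈ)` is the Banach space of bounded continuous vector fields
with the sup norm. Only the values `u t` with `t ∈ [0,T]` matter. -/
def MemL1C0 {d : ℕ} (T : ℝ≥0) (u : ℝ → (Space d →ᵇ Space d)) : Prop :=
  IntegrableOn u (Icc (0 : ℝ) T) volume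

/-- A random velocity field on `[0,T] × ℝᵈ`, defined on `Ω`: it is jointly measurable in `(ω, t, x)`
and each of its realizations is a drift in `L¹([0,T], C⁰(ℝᵈ))`. -/
structure IsRandomVelocityField {Ω : Type} [MeasurableSpace Ω] {d : ℕ} (T : ℝ≥0)
    (u : Ω → ℝ → (Space d →ᵇ Space d)) : Prop where
  measurable : Measurable fun p : Ω × ℝ × Space d => u p.1 p.2.1 p.2.2
  memL1C0 : ∀ ω, MemL1C0 T (u ω)

/-- `X ∈ C⁰([0,T], ℝᵈ)` is a Carathéodory solution of `dX = u(t,X) dt + dW`, `X_0 = y`: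
`X_t = y + ∫₀ᵗ u(s, X_s) ds + W_t - W_0` for all `t ∈ [0,T]`. For a drift in `L¹([0,T], C⁰(ℝᵈ))`,
the only kind to which this is applied, the integrand is automatically integrable. (`IccExtend`
only turns `X` into a function on the real line; it agrees with `X` on `[0,T]`.) -/
def IsCaratheodorySolution {d : ℕ} {T : ℝ≥0} (u : ℝ → (Space d →ᵇ Space d)) (y : Space d)
    (W X : Path0 d T) : Prop :=
  ∀ t : Icc (0 : ℝ) T,
    X t = y + (∫ s in (0 : ℝ)..t, u s (IccExtend T.2 X s)) + W t - W (startTime T)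

/-- The ODE driven by the path `W` has at least two distinct Carathéodory solutions on `[0,T]`. -/
def HasNonuniqueSolutions {d : ℕ} {T : ℝ≥0} (u : ℝ → (Space d →ᵇ Space d)) (y : Space d)
    (W : Path0 d T) : Prop :=
  ∃ X₁ X₂ : Path0 d T,
    IsCaratheodorySolution u y W X₁ ∧ IsCaratheodorySolution u y W X₂ ∧ X₁ ≠ X₂

/-- Path-by-path uniqueness: for almost every realization `W` of the driving noise, whose law is
`ν`, there is a unique Carathéodory solution. -/
def PathByPathUniqueness {d : ℕ} {T : ℝ≥0} (u : ℝ → (Space d →ᵇ Space d)) (y : Space d)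
    (ν : Measure (Path0 d T)) : Prop :=
  ∀ᵐ W ∂ν, ∃! X : Path0 d T, IsCaratheodorySolution u y W X

/-- `ν` is the law on `C⁰([0,T], ℝᵈ)` of `d`-dimensional fractional Brownian motion with Hurst
parameter `H`: the coordinate process is a centered Gaussian process with covariance
`E[W_{t,i} W_{s,j}] = δ_{ij} (t^{2H} + s^{2H} - |t-s|^{2H}) / 2`. -/
structure IsFractionalBrownianLaw {d : ℕ} {T : ℝ≥0} (H : ℝ) (ν : Measure (Path0 d T)) : Prop where
  isProbabilityMeasure : IsProbabilityMeasure ν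
  isGaussianProcess :
    IsGaussianProcess (fun (t : Icc (0 : ℝ) T) (W : Path0 d T) => W t) ν
  centered : ∀ (t : Icc (0 : ℝ) T) (i : Fin d), ∫ W : Path0 d T, W t i ∂ν = 0
  covariance : ∀ (t s : Icc (0 : ℝ) T) (i j : Fin d),
    ∫ W : Path0 d T, W t i * W s j ∂ν =
      if i = j then ((t : ℝ) ^ (2 * H) + (s : ℝ) ^ (2 * H) - |(t : ℝ) - s| ^ (2 * H)) / 2 else 0

end

/-! ### Anti-concentration of signed sums -/

/-- The sign `±1` encoded by a Boolean. -/
def signOf (b : Bool) : ℝ := if b then 1 else -1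

lemma abs_signOf (b : Bool) : |signOf b| = 1 := by cases b <;> simp [signOf]

lemma signOf_xor (a b : Bool) : signOf (xor a b) = -(signOf a * signOf b) := by
  cases a <;> cases b <;> simp [signOf]

/-- The Littlewood–Offord bound: a half-open interval of length `2a` contains few of the
signed sums of numbers that are at least `a` in absolute value. -/
lemma card_signed_sum_mem_Ico_le {ι : Type*} [Fintype ι] [DecidableEq ι] (b : ι → ℝ) {a : ℝ}
    (ha : 0 < a) (hb : ∀ i, a ≤ |b i|) (x : ℝ) :
    (Finset.univ.filter fun e : ι → Bool => ∑ i, signOf (e i) * b i ∈ Ico x (x + 2 * a)).card ≤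
      (Fintype.card ι).choose (Fintype.card ι / 2) := by
  set S : (ι → Bool) → Finset ι := fun e => Finset.univ.filter fun i => 0 < signOf (e i) * b i
    with hS
  have hb0 : ∀ i, b i ≠ 0 := fun i h => by have := hb i; rw [h, abs_zero] at this; linarith
  have hSmem : ∀ e i, i ∈ S e ↔ 0 < signOf (e i) * b i := fun e i => by simp [hS]
  have hval : ∀ e i, (i ∈ S e → signOf (e i) * b i = |b i|) ∧
      (i ∉ S e → signOf (e i) * b i = -|b i|) := by
    intro e i
    rw [hSmem]
    have habs : |signOf (e i) * b i| = |b i| := by rw [abs_mul, abs_signOf, one_mul]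
    constructor
    · intro h; rw [← habs, abs_of_pos h]
    · intro h; rw [← habs, abs_of_nonpos (not_lt.1 h), neg_neg]
  have hinj : Function.Injective S := by
    intro e e' h
    funext i
    have h1 : signOf (e i) * b i = signOf (e' i) * b i := by
      by_cases hi : i ∈ S e
      · rw [(hval e i).1 hi, (hval e' i).1 (h ▸ hi)]
      · rw [(hval e i).2 hi, (hval e' i).2 (h ▸ hi)]
    have h2 := mul_right_cancel₀ (hb0 i) h1
    revert h2
    cases e i <;> cases e' i <;> norm_num [signOf]
  rw [← Finset.card_image_of_injective _ hinj]
  apply IsAntichain.sperner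
  rintro _ hA _ hB hne hsub
  simp only [Finset.coe_image, Finset.coe_filter, Finset.mem_univ, true_and, Set.mem_image,
    Set.mem_ofPred_eq] at hA hB
  obtain ⟨e, he, rfl⟩ := hA
  obtain ⟨e', he', rfl⟩ := hB
  obtain ⟨i₀, hi₀', hi₀⟩ : ∃ i, i ∈ S e' ∧ i ∉ S e := by
    by_contra! hcon
    exact hne (Finset.Subset.antisymm hsub hcon)
  have key : ∀ i, (if i = i₀ then 2 * a else 0) ≤ signOf (e' i) * b i - signOf (e i) * b i := by
    intro i
    split_ifs with h
    · subst h
      rw [(hval e' i).1 hi₀', (hval e i).2 hi₀]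
      linarith [hb i]
    · by_cases hi : i ∈ S e
      · rw [(hval e i).1 hi, (hval e' i).1 (hsub hi)]; simp
      · rw [(hval e i).2 hi]
        have : -|b i| ≤ signOf (e' i) * b i := by
          have := neg_abs_le (signOf (e' i) * b i)
          rwa [abs_mul, abs_signOf, one_mul] at this
        linarith
  have hsum := Finset.sum_le_sum fun i (_ : i ∈ Finset.univ) => key i
  rw [Finset.sum_ite_eq' Finset.univ i₀, Finset.sum_sub_distrib] at hsum
  simp only [Finset.mem_univ, if_true] at hsum
  linarith [he.1, he'.2]

lemma card_abs_signed_sum_lt_le {ι : Type*} [Fintype ι] [DecidableEq ι] (b : ι → ℝ) {a : ℝ}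
    (ha : 0 < a) (hb : ∀ i, a ≤ |b i|) (R L : ℝ) :
    (Finset.univ.filter fun e : ι → Bool => |R + ∑ i, signOf (e i) * b i| < L).card ≤
      ⌈L / a⌉₊ * (Fintype.card ι).choose (Fintype.card ι / 2) := by
  have hsub : (Finset.univ.filter fun e : ι → Bool => |R + ∑ i, signOf (e i) * b i| < L) ⊆
      (Finset.range ⌈L / a⌉₊).biUnion fun k => Finset.univ.filter fun e : ι → Bool =>
        ∑ i, signOf (e i) * b i ∈ Ico (-R - L + 2 * a * k) (-R - L + 2 * a * k + 2 * a) := by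
    intro e he
    simp only [Finset.mem_filter, Finset.mem_univ, true_and, Finset.mem_biUnion,
      Finset.mem_range] at he ⊢
    set s := ∑ i, signOf (e i) * b i
    obtain ⟨h1, h2⟩ := abs_lt.1 he
    have h0 : 0 ≤ (s + R + L) / (2 * a) := by apply div_nonneg <;> linarith
    refine ⟨⌊(s + R + L) / (2 * a)⌋₊, ?_, ?_, ?_⟩
    · rw [Nat.floor_lt h0]
      refine lt_of_lt_of_le ?_ (Nat.le_ceil _)
      rw [div_lt_div_iff₀ (by linarith) ha]
      nlinarith
    · have := Nat.floor_le h0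
      rw [le_div_iff₀ (by linarith)] at this
      linarith
    · have := Nat.lt_floor_add_one ((s + R + L) / (2 * a))
      rw [div_lt_iff₀ (by linarith)] at this
      linarith
  refine (Finset.card_le_card hsub).trans (Finset.card_biUnion_le.trans ?_)
  refine (Finset.sum_le_sum fun k _ => card_signed_sum_mem_Ico_le b ha hb _).trans ?_
  simp

lemma sq_centralBinom_mul_le (k : ℕ) : k.centralBinom ^ 2 * (2 * k + 1) ≤ 16 ^ k := by
  induction k with
  | zero => simp
  | succ k ih =>
    have h := Nat.succ_mul_centralBinom_succ k
    have h2 : (k + 1) ^ 2 * ((k + 1).centralBinom ^ 2 * (2 * (k + 1) + 1)) =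
        4 * (2 * k + 1) * (2 * k + 3) * (k.centralBinom ^ 2 * (2 * k + 1)) := by
      calc _ = ((k + 1) * (k + 1).centralBinom) ^ 2 * (2 * k + 3) := by ring
        _ = _ := by rw [h]; ring
    have h3 : 4 * (2 * k + 1) * (2 * k + 3) * (k.centralBinom ^ 2 * (2 * k + 1)) ≤
        (k + 1) ^ 2 * 16 ^ (k + 1) := by
      refine (Nat.mul_le_mul_left _ ih).trans ?_
      rw [pow_succ (16 : ℕ) k]
      have : 4 * (2 * k + 1) * (2 * k + 3) ≤ (k + 1) ^ 2 * 16 := by ring_nf; omega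
      calc _ ≤ (k + 1) ^ 2 * 16 * 16 ^ k := Nat.mul_le_mul_right _ this
        _ = _ := by ring
    rw [← h2] at h3
    exact Nat.le_of_mul_le_mul_left h3 (by positivity)

lemma choose_half_le {k : ℕ} (hk : 0 < k) :
    (((2 * k).choose (2 * k / 2) : ℕ) : ℝ) ≤ 2 ^ (2 * k) / √((2 * k : ℕ) : ℝ) := by
  have h : ((k.centralBinom : ℝ)) ^ 2 * (2 * k + 1) ≤ 16 ^ k := by
    exact_mod_cast sq_centralBinom_mul_le k
  have hk' : (0 : ℝ) < k := by exact_mod_cast hk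
  rw [Nat.mul_div_cancel_left _ (by norm_num), ← Nat.centralBinom_eq_two_mul_choose,
    le_div_iff₀ (by positivity)]
  refine le_of_sq_le_sq ?_ (by positivity)
  rw [mul_pow, Real.sq_sqrt (by positivity), ← pow_mul]
  push_cast
  calc (k.centralBinom : ℝ) ^ 2 * (2 * k) ≤ (k.centralBinom : ℝ) ^ 2 * (2 * k + 1) := by
        gcongr; linarith
    _ ≤ 16 ^ k := h
    _ = _ := by rw [show 2 * k * 2 = 4 * k by ring, pow_mul]; norm_num

/-- Anti-concentration: the number of sign choices for which the shifted signed sum is small. -/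
lemma card_abs_signed_sum_lt_le_div_sqrt {k : ℕ} (hk : 0 < k) (b : Fin (2 * k) → ℝ) {a : ℝ}
    (ha : 0 < a) (hb : ∀ i, a ≤ |b i|) (R : ℝ) {L : ℝ} (hL : 0 ≤ L) :
    ((Finset.univ.filter fun e : Fin (2 * k) → Bool =>
        |R + ∑ i, signOf (e i) * b i| < L).card : ℝ) ≤
      (L / a + 1) / √((2 * k : ℕ) : ℝ) * 2 ^ (2 * k) := by
  have h := card_abs_signed_sum_lt_le b ha hb R L
  rw [Fintype.card_fin] at h
  calc _ ≤ ((⌈L / a⌉₊ * (2 * k).choose (2 * k / 2) : ℕ) : ℝ) := by exact_mod_cast h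
    _ ≤ (L / a + 1) * (2 ^ (2 * k) / √((2 * k : ℕ) : ℝ)) := by
        push_cast
        gcongr
        · exact (Nat.ceil_lt_add_one (by positivity)).le
        · simpa only [Nat.cast_mul, Nat.cast_ofNat] using choose_half_le hk
    _ = _ := by ring

/-! ### Independent fair coins -/

noncomputable section

/-- The law of a fair coin. -/
def fairCoin : Measure Bool := (2⁻¹ : ℝ≥0∞) • Measure.count

instance isProbabilityMeasure_fairCoin : IsProbabilityMeasure fairCoin := ⟨by
  simp only [fairCoin, Measure.smul_apply, smul_eq_mul]
  rw [← Finset.coe_univ, Measure.count_apply_finset, Finset.card_univ, Fintype.card_bool]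
  exact ENNReal.inv_mul_cancel (by simp) (by simp)⟩

lemma map_xor_fairCoin (b : Bool) : fairCoin.map (fun a => xor a b) = fairCoin := by
  have hcount : (Measure.count : Measure Bool).map (fun a => xor a b) = Measure.count := by
    refine Measure.ext_of_singleton fun a => ?_
    rw [Measure.map_apply (measurable_of_countable _) (measurableSet_singleton _)]
    have : (fun a => xor a b) ⁻¹' {a} = {xor a b} := by
      ext c; cases a <;> cases b <;> cases c <;> simp
    rw [this, Measure.count_singleton, Measure.count_singleton]
  rw [fairCoin, Measure.map_smul, hcount]

/-- The law of a family of independent fair coins. -/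
def coinMeasure (ι : Type*) : Measure (ι → Bool) := Measure.infinitePi fun _ => fairCoin

instance isProbabilityMeasure_coinMeasure (ι : Type*) : IsProbabilityMeasure (coinMeasure ι) := by
  unfold coinMeasure; infer_instance

lemma measurePreserving_xor {ι : Type*} (e : ι → Bool) :
    MeasurePreserving (fun (ω : ι → Bool) i => xor (ω i) (e i)) (coinMeasure ι) (coinMeasure ι) := by
  refine ⟨measurable_pi_lambda _ fun i =>
    (measurable_of_countable fun a : Bool => xor a (e i)).comp (measurable_pi_apply i), ?_⟩
  rw [coinMeasure, Measure.infinitePi_map_pi (μ := fun _ : ι => fairCoin)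
    (f := fun i a => xor a (e i)) fun i => measurable_of_countable _]
  simp_rw [map_xor_fairCoin]

/-- If, at every point of `A`, at most a fraction `p` of the flips `e i` lead into `B`, and `B` can
only be reached from `A`, then `B` has at most `p` times the mass of `A`. -/
lemma coinMeasure_le_mul_of_flips {ι κ : Type*} [Fintype κ] [Nonempty κ] (e : κ → ι → Bool)
    {A B : Set (ι → Bool)} (hA : MeasurableSet A) (hB : MeasurableSet B) (p : ℝ≥0∞)
    (hAB : ∀ ω ∉ A, ∀ i, (fun j => xor (ω j) (e i j)) ∉ B)
    (h : ∀ ω ∈ A, ∑ i, B.indicator (1 : (ι → Bool) → ℝ≥0∞) (fun j => xor (ω j) (e i j)) ≤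
      p * Fintype.card κ) :
    coinMeasure ι B ≤ p * coinMeasure ι A := by
  have hcard0 : (Fintype.card κ : ℝ≥0∞) ≠ 0 := by simp
  have hmeas : ∀ i, Measurable fun ω : ι → Bool =>
      B.indicator (1 : (ι → Bool) → ℝ≥0∞) (fun j => xor (ω j) (e i j)) := fun i =>
    (measurable_one.indicator hB).comp (measurePreserving_xor (e i)).measurable
  have h1 : ∀ i, ∫⁻ ω, B.indicator (1 : (ι → Bool) → ℝ≥0∞) (fun j => xor (ω j) (e i j))
      ∂coinMeasure ι = coinMeasure ι B := fun i => by
    rw [(measurePreserving_xor (e i)).lintegral_comp (measurable_one.indicator hB),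
      lintegral_indicator_one hB]
  have h2 : (Fintype.card κ : ℝ≥0∞) * coinMeasure ι B ≤
      (Fintype.card κ : ℝ≥0∞) * (p * coinMeasure ι A) := by
    calc (Fintype.card κ : ℝ≥0∞) * coinMeasure ι B
        = ∑ i : κ, ∫⁻ ω, B.indicator (1 : (ι → Bool) → ℝ≥0∞) (fun j => xor (ω j) (e i j))
            ∂coinMeasure ι := by simp [h1]
      _ = ∫⁻ ω, ∑ i : κ, B.indicator (1 : (ι → Bool) → ℝ≥0∞) (fun j => xor (ω j) (e i j))
            ∂coinMeasure ι := (lintegral_finsetSum _ fun i _ => hmeas i).symm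
      _ ≤ ∫⁻ ω, A.indicator (fun _ => p * Fintype.card κ) ω ∂coinMeasure ι := by
          refine lintegral_mono fun ω => ?_
          by_cases hω : ω ∈ A
          · simpa [hω] using h ω hω
          · simp [hω, hAB ω hω]
      _ = _ := by rw [lintegral_indicator_const hA]; ring
  exact (ENNReal.mul_le_mul_iff_right hcard0 (by simp)).1 h2

end

/-! ### Random shear profiles -/

/-- The tent function. -/
def tent (x : ℝ) : ℝ := max 0 (1 - |x|)

@[fun_prop]
lemma continuous_tent : Continuous tent := by unfold tent; fun_prop

/-- Linear interpolation of a sequence indexed by the integers. -/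
noncomputable def interp (ε : ℤ → ℝ) (x : ℝ) : ℝ :=
  (1 - Int.fract x) * ε ⌊x⌋ + Int.fract x * ε (⌊x⌋ + 1)

lemma abs_interp_le {ε : ℤ → ℝ} (hε : ∀ k, |ε k| ≤ 1) (x : ℝ) : |interp ε x| ≤ 1 := by
  have h0 := Int.fract_nonneg x
  have h1 := (Int.fract_lt_one x).le
  have ha := abs_le.1 (hε ⌊x⌋)
  have hb := abs_le.1 (hε (⌊x⌋ + 1))
  unfold interp
  rw [abs_le]
  constructor <;> nlinarith

lemma abs_interp_sub_le {ε : ℤ → ℝ} (hε : ∀ k, |ε k| ≤ 1) (x y : ℝ) :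
    |interp ε x - interp ε y| ≤ 2 * |x - y| := by
  wlog hxy : y ≤ x generalizing x y
  · rw [abs_sub_comm, abs_sub_comm x]
    exact this y x (le_of_not_ge hxy)
  have hdiff : ∀ k, |ε (k + 1) - ε k| ≤ 2 := fun k => by
    have ha := abs_le.1 (hε k)
    have hb := abs_le.1 (hε (k + 1))
    rw [abs_le]; constructor <;> linarith
  rw [abs_of_nonneg (sub_nonneg.2 hxy)]
  by_cases hfar : 1 ≤ x - y
  · have ha := abs_le.1 (abs_interp_le hε x)
    have hb := abs_le.1 (abs_interp_le hε y)
    rw [abs_le]; constructor <;> linarith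
  have hx := Int.floor_add_fract x
  have hy := Int.floor_add_fract y
  have hfx0 := Int.fract_nonneg x
  have hfy1 := (Int.fract_lt_one y).le
  have hle : ⌊y⌋ ≤ ⌊x⌋ := Int.floor_le_floor hxy
  have hle' : ⌊x⌋ ≤ ⌊y⌋ + 1 := by
    rw [← Int.floor_add_one]; exact Int.floor_le_floor (by linarith)
  rcases hle.eq_or_lt with h | h
  · have hf : x - y = Int.fract x - Int.fract y := by rw [← h] at hx; linarith
    have : interp ε x - interp ε y = (x - y) * (ε (⌊y⌋ + 1) - ε ⌊y⌋) := by
      rw [hf]; unfold interp; rw [h]; ring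
    rw [this, abs_mul, abs_of_nonneg (sub_nonneg.2 hxy), mul_comm]
    exact mul_le_mul_of_nonneg_right (hdiff _) (sub_nonneg.2 hxy)
  · have h' : ⌊x⌋ = ⌊y⌋ + 1 := by omega
    have hf : x - y = Int.fract x + (1 - Int.fract y) := by
      rw [h'] at hx; push_cast at hx; linarith
    have : interp ε x - interp ε y = Int.fract x * (ε (⌊y⌋ + 1 + 1) - ε (⌊y⌋ + 1)) +
        (1 - Int.fract y) * (ε (⌊y⌋ + 1) - ε ⌊y⌋) := by
      unfold interp; rw [h']; ring
    rw [this, hf]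
    refine (abs_add_le _ _).trans ?_
    rw [abs_mul, abs_mul, abs_of_nonneg hfx0, abs_of_nonneg (sub_nonneg.2 hfy1)]
    nlinarith [hdiff ⌊y⌋, hdiff (⌊y⌋ + 1)]

lemma interp_sub_interp_of_eq_off {ε ε' : ℤ → ℝ} {κ : ℤ} (h : ∀ k, k ≠ κ → ε' k = ε k) (x : ℝ) :
    interp ε' x - interp ε x = (ε' κ - ε κ) * tent (x - κ) := by
  have hx := Int.floor_add_fract x
  have h0 := Int.fract_nonneg x
  have h1 := (Int.fract_lt_one x).le
  rcases lt_trichotomy κ ⌊x⌋ with hκ | hκ | hκ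
  · have hc : (κ : ℝ) + 1 ≤ ⌊x⌋ := by exact_mod_cast hκ
    have ht : tent (x - κ) = 0 := max_eq_left (by rw [abs_of_nonneg] <;> linarith)
    rw [ht]; unfold interp
    rw [h _ (by omega), h (⌊x⌋ + 1) (by omega)]; ring
  · have ht : tent (x - κ) = 1 - Int.fract x := by
      unfold tent
      rw [show x - κ = Int.fract x by rw [hκ]; linarith, abs_of_nonneg h0]
      exact max_eq_right (by linarith)
    rw [ht]; unfold interp
    rw [h (⌊x⌋ + 1) (by omega), hκ]; ring
  · rcases (Int.add_one_le_iff.2 hκ).eq_or_lt with hκ' | hκ'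
    · have hc : (κ : ℝ) = ⌊x⌋ + 1 := by exact_mod_cast hκ'.symm
      have ht : tent (x - κ) = Int.fract x := by
        unfold tent
        rw [abs_of_nonpos (by linarith)]
        rw [max_eq_right] <;> linarith
      rw [ht]; unfold interp
      rw [h ⌊x⌋ (by omega), hκ']; ring
    · have hc : (⌊x⌋ : ℝ) + 1 + 1 ≤ κ := by exact_mod_cast hκ'
      have ht : tent (x - κ) = 0 :=
        max_eq_left (by rw [abs_of_nonpos] <;> linarith)
      rw [ht]; unfold interp
      rw [h _ (by omega), h (⌊x⌋ + 1) (by omega)]; ring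

lemma continuous_interp {ε : ℤ → ℝ} (hε : ∀ k, |ε k| ≤ 1) : Continuous (interp ε) := by
  have : LipschitzWith 2 (interp ε) := LipschitzWith.of_dist_le_mul fun x y => by
    simpa [Real.dist_eq] using abs_interp_sub_le hε x y
  exact this.continuous

lemma abs_signOf_comp_le (ε : ℤ → Bool) (k : ℤ) : |(signOf ∘ ε) k| ≤ 1 := (abs_signOf _).le

lemma continuous_euclideanSpace_single (c : Fin 2) :
    Continuous fun a : ℝ => (EuclideanSpace.single c a : Space 2) :=
  (PiLp.continuous_toLp 2 fun _ : Fin 2 => ℝ).comp (continuous_single (A := fun _ : Fin 2 => ℝ) c)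

noncomputable section

/-- The shear flow in direction `c` with amplitude `A`, whose profile interpolates the signs `ε` at
scale `s`. -/
def shearField (c : Fin 2) (A s : ℝ) (ε : ℤ → Bool) : Space 2 →ᵇ Space 2 :=
  BoundedContinuousFunction.ofNormedAddCommGroup
    (fun x => EuclideanSpace.single c (A * interp (signOf ∘ ε) (x (c + 1) / s)))
    (by
      have h := continuous_interp (abs_signOf_comp_le ε)
      have h2 : Continuous fun x : Space 2 => A * interp (signOf ∘ ε) (x (c + 1) / s) := by
        fun_prop
      exact (continuous_euclideanSpace_single c).comp h2)
    |A|
    (by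
      intro x
      rw [PiLp.norm_single, Real.norm_eq_abs, abs_mul]
      exact mul_le_of_le_one_right (abs_nonneg _) (abs_interp_le (abs_signOf_comp_le ε) _))

lemma shearField_apply (c : Fin 2) (A s : ℝ) (ε : ℤ → Bool) (x : Space 2) :
    shearField c A s ε x =
      EuclideanSpace.single c (A * interp (signOf ∘ ε) (x (c + 1) / s)) := rfl

lemma norm_shearField_apply_le (c : Fin 2) (A s : ℝ) (ε : ℤ → Bool) (x : Space 2) :
    ‖shearField c A s ε x‖ ≤ |A| := by
  rw [shearField_apply, PiLp.norm_single, Real.norm_eq_abs, abs_mul]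
  exact mul_le_of_le_one_right (abs_nonneg _) (abs_interp_le (abs_signOf_comp_le ε) _)

lemma dist_shearField_apply_le (c : Fin 2) {α : ℝ} (hα0 : 0 ≤ α) (hα1 : α ≤ 1) {s : ℝ} (hs : 0 < s)
    (ε : ℤ → Bool) (x y : Space 2) :
    dist (shearField c (s ^ α / 2) s ε x) (shearField c (s ^ α / 2) s ε y) ≤ dist x y ^ α := by
  have hr : |x (c + 1) - y (c + 1)| ≤ dist x y := by
    have := PiLp.norm_apply_le (x - y) (c + 1)
    rw [dist_eq_norm]; simpa using this
  set r := dist x y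
  have hr0 : 0 ≤ r := dist_nonneg
  have hsα : 0 < s ^ α := Real.rpow_pos_of_pos hs _
  rw [shearField_apply, shearField_apply, dist_eq_norm, ← PiLp.single_sub,
    PiLp.norm_single, Real.norm_eq_abs, ← mul_sub, abs_mul, abs_of_pos (half_pos hsα)]
  set f := interp (signOf ∘ ε)
  have h1 : |f (x (c + 1) / s) - f (y (c + 1) / s)| ≤ 2 * (r / s) := by
    refine (abs_interp_sub_le (abs_signOf_comp_le ε) _ _).trans ?_
    rw [← sub_div, abs_div, abs_of_pos hs]
    gcongr
  have h2 : |f (x (c + 1) / s) - f (y (c + 1) / s)| ≤ 2 := by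
    have ha := abs_le.1 (abs_interp_le (abs_signOf_comp_le ε) (x (c + 1) / s))
    have hb := abs_le.1 (abs_interp_le (abs_signOf_comp_le ε) (y (c + 1) / s))
    rw [abs_le]; constructor <;> linarith
  have h3 : |f (x (c + 1) / s) - f (y (c + 1) / s)| ≤ 2 * (r / s) ^ α := by
    rcases le_total 1 (r / s) with h | h
    · have := Real.one_le_rpow h hα0
      linarith
    · have := Real.rpow_le_rpow_of_exponent_ge_of_imp (div_nonneg hr0 hs.le) h hα1
        (fun h h' => by norm_num at *)
      rw [Real.rpow_one] at this
      linarith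
  calc s ^ α / 2 * |f (x (c + 1) / s) - f (y (c + 1) / s)|
      ≤ s ^ α / 2 * (2 * (r / s) ^ α) := by gcongr
    _ = r ^ α := by
      rw [Real.div_rpow hr0 hs.le]; field_simp

lemma holderNorm_shearField_le (c : Fin 2) {α : ℝ≥0} (hα1 : α ≤ 1) {s : ℝ} (hs : 0 < s)
    (hs1 : s ≤ 1) (ε : ℤ → Bool) :
    holderNorm α (shearField c (s ^ (α : ℝ) / 2) s ε) ≤ 2 := by
  have h1 : (⨆ x, ‖shearField c (s ^ (α : ℝ) / 2) s ε x‖ₑ) ≤ 1 := by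
    refine iSup_le fun x => ?_
    rw [← ofReal_norm, ← ENNReal.ofReal_one]
    refine ENNReal.ofReal_le_ofReal ((norm_shearField_apply_le _ _ _ _ _).trans ?_)
    have h0 := Real.rpow_nonneg hs.le (α : ℝ)
    rw [abs_of_nonneg (by positivity)]
    linarith [Real.rpow_le_one hs.le hs1 α.coe_nonneg]
  have h2 : (if α = 0 then 0 else eHolderNorm α (shearField c (s ^ (α : ℝ) / 2) s ε)) ≤ 1 := by
    split_ifs
    · exact zero_le
    · refine HolderWith.eHolderNorm_le (C := 1) fun x y => ?_
      rw [edist_dist, edist_dist, ENNReal.coe_one, one_mul,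
        ENNReal.ofReal_rpow_of_nonneg dist_nonneg α.coe_nonneg]
      exact ENNReal.ofReal_le_ofReal (dist_shearField_apply_le c α.coe_nonneg (by exact_mod_cast hα1) hs ε x y)
  calc _ ≤ (1 : ℝ≥0∞) + 1 := add_le_add h1 h2
    _ = 2 := one_add_one_eq_two

/-! ### The random velocity field -/

/-- Stage `n` is the time interval `(2⁻ⁿ⁻¹, 2⁻ⁿ]`. -/
def stageTime (n : ℕ) : ℝ := (1 / 2) ^ n

/-- The stage containing a given time. -/
def stageOf (t : ℝ) : ℕ := Nat.log 2 ⌊t⁻¹⌋₊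

/-- The direction of the shears of stage `n`; they alternate. -/
def stageDir (n : ℕ) : Fin 2 := Fin.ofNat 2 n

lemma stageDir_succ (n : ℕ) : stageDir (n + 1) = stageDir n + 1 := by
  ext; simp [stageDir, Fin.val_add]

/-- The length scale of the shears of stage `n`. -/
def shearScale (n : ℕ) : ℝ := (1 / 2) ^ ((n + 1) ^ 2 + 1)

/-- The separation of trajectories aimed for at the end of stage `n`. -/
def gapScale (n : ℕ) : ℝ := (1 / 2) ^ (n ^ 2)

/-- Half the number of time blocks of stage `n` is `2` to this power. -/
def blockExp (α : ℝ) (n : ℕ) : ℕ := ⌊2 * (1 - α) * n ^ 2⌋₊ - 10 * n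

/-- The number of time blocks of stage `n`. -/
def numBlocks (α : ℝ) (n : ℕ) : ℕ := 2 * 2 ^ blockExp α n

/-- The length of the time blocks of stage `n`. -/
def blockLen (α : ℝ) (n : ℕ) : ℝ := (1 / 2) ^ (blockExp α n + n + 2)

/-- The amplitude of the shears of stage `n`. -/
def shearAmp (α : ℝ) (n : ℕ) : ℝ := shearScale n ^ α / 2

/-- The signs are indexed by stage, time block and node of the profile. -/
abbrev SignIndex : Type := ℕ × ℕ × ℤ

abbrev SignSpace : Type := SignIndex → Bool

/-- The velocity field: alternating random shears whose scales accumulate at time `0`. -/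
def velocity (α : ℝ) (ω : SignSpace) (t : ℝ) : Space 2 →ᵇ Space 2 :=
  shearField (stageDir (stageOf t)) (shearAmp α (stageOf t)) (shearScale (stageOf t))
    fun k => ω (stageOf t, ⌊t / blockLen α (stageOf t)⌋₊, k)

lemma stageTime_pos (n : ℕ) : 0 < stageTime n := by unfold stageTime; positivity

lemma shearScale_pos (n : ℕ) : 0 < shearScale n := by unfold shearScale; positivity

lemma gapScale_pos (n : ℕ) : 0 < gapScale n := by unfold gapScale; positivity

lemma blockLen_pos (α : ℝ) (n : ℕ) : 0 < blockLen α n := by unfold blockLen; positivity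

lemma shearScale_le_one (n : ℕ) : shearScale n ≤ 1 :=
  pow_le_one₀ (by norm_num) (by norm_num)

lemma shearAmp_pos (α : ℝ) (n : ℕ) : 0 < shearAmp α n :=
  half_pos (Real.rpow_pos_of_pos (shearScale_pos n) _)

lemma shearAmp_le_one {α : ℝ} (hα : 0 ≤ α) (n : ℕ) : shearAmp α n ≤ 1 := by
  have := Real.rpow_le_one (shearScale_pos n).le (shearScale_le_one n) hα
  unfold shearAmp; linarith

lemma gapScale_succ (n : ℕ) : gapScale (n + 1) = 2 * shearScale n := by
  unfold gapScale shearScale; rw [pow_succ _ ((n + 1) ^ 2)]; ring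

lemma stageTime_succ (n : ℕ) : stageTime (n + 1) = stageTime n / 2 := by
  unfold stageTime; rw [pow_succ]; ring

lemma numBlocks_mul_blockLen (α : ℝ) (n : ℕ) :
    numBlocks α n * blockLen α n = stageTime (n + 1) := by
  unfold numBlocks blockLen stageTime
  rw [show blockExp α n + n + 2 = blockExp α n + 1 + (n + 1) by ring, pow_add, pow_succ]
  push_cast
  rw [← mul_assoc]
  have : (2 * 2 ^ blockExp α n * ((1 / 2) ^ blockExp α n * (1 / 2)) : ℝ) = 1 := by
    rw [show (2 * 2 ^ blockExp α n * ((1 / 2) ^ blockExp α n * (1 / 2)) : ℝ) =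
      (2 * (1 / 2)) ^ blockExp α n by rw [mul_pow]; ring]
    norm_num
  rw [this, one_mul]

lemma stageOf_eq {n : ℕ} {t : ℝ} (h1 : stageTime (n + 1) < t) (h2 : t ≤ stageTime n) :
    stageOf t = n := by
  have ht : 0 < t := (stageTime_pos _).trans h1
  unfold stageOf
  rw [Nat.log_eq_iff (Or.inr ⟨by norm_num, ?_⟩)]
  · constructor
    · apply Nat.le_floor
      rw [le_inv_comm₀ (by positivity) ht]
      simpa [stageTime] using h2
    · rw [Nat.floor_lt (by positivity), inv_lt_comm₀ ht (by positivity)]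
      simpa [stageTime] using h1
  · have : 1 ≤ ⌊t⁻¹⌋₊ := by
      apply Nat.le_floor
      rw [Nat.cast_one, one_le_inv₀ ht]
      exact h2.trans (pow_le_one₀ (by norm_num) (by norm_num))
    omega

lemma le_stageOf {n : ℕ} {t : ℝ} (h0 : 0 < t) (h : t ≤ stageTime n) : n ≤ stageOf t := by
  unfold stageOf
  have h1 : 2 ^ n ≤ ⌊t⁻¹⌋₊ := by
    apply Nat.le_floor
    rw [le_inv_comm₀ (by positivity) h0]
    simpa [stageTime] using h
  exact Nat.le_log_of_pow_le (by norm_num) h1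

@[fun_prop]
lemma measurable_stageOf : Measurable stageOf :=
  (measurable_of_countable (Nat.log 2)).comp (Nat.measurable_floor.comp measurable_inv)

lemma measurable_blockIndex (α : ℝ) :
    Measurable fun t : ℝ => ⌊t / blockLen α (stageOf t)⌋₊ :=
  Nat.measurable_floor.comp
    (measurable_id.div ((measurable_of_countable (blockLen α)).comp measurable_stageOf))

lemma norm_velocity_apply_le {α : ℝ} (hα : 0 ≤ α) (ω : SignSpace) (t : ℝ) (x : Space 2) :
    ‖velocity α ω t x‖ ≤ 1 := by
  refine (norm_shearField_apply_le _ _ _ _ _).trans ?_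
  rw [abs_of_pos (shearAmp_pos _ _)]
  exact shearAmp_le_one hα _

lemma holderNorm_velocity_le {α : ℝ≥0} (hα : α ≤ 1) (ω : SignSpace) (t : ℝ) :
    holderNorm α (velocity α ω t) ≤ 2 :=
  holderNorm_shearField_le _ hα (shearScale_pos _) (shearScale_le_one _) _

lemma measurable_velocity (α : ℝ) :
    Measurable fun p : SignSpace × ℝ × Space 2 => velocity α p.1 p.2.1 p.2.2 := by
  have heval : Measurable fun q : SignSpace × SignIndex => signOf (q.1 q.2) :=
    (measurable_of_countable signOf).comp
      (measurable_from_prod_countable_left fun i => measurable_pi_apply i)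
  have hst : Measurable fun p : SignSpace × ℝ × Space 2 => stageOf p.2.1 := by fun_prop
  have hbl : Measurable fun p : SignSpace × ℝ × Space 2 =>
      ⌊p.2.1 / blockLen α (stageOf p.2.1)⌋₊ :=
    (measurable_blockIndex α).comp (measurable_fst.comp measurable_snd)
  have hx : Measurable fun p : SignSpace × ℝ × Space 2 =>
      p.2.2 (stageDir (stageOf p.2.1) + 1) / shearScale (stageOf p.2.1) := by
    have h1 : Measurable fun q : (Space 2) × ℕ => q.1 ((stageDir q.2) + 1) / shearScale q.2 :=
      measurable_from_prod_countable_left fun n =>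
      (by fun_prop : Measurable fun x : Space 2 => x (stageDir n + 1)).div_const (shearScale n)
    exact h1.comp ((measurable_snd.comp measurable_snd).prodMk hst)
  have hfl : Measurable fun p : SignSpace × ℝ × Space 2 =>
      ⌊p.2.2 (stageDir (stageOf p.2.1) + 1) / shearScale (stageOf p.2.1)⌋ := hx.floor
  have hA : Measurable fun p : SignSpace × ℝ × Space 2 => shearAmp α (stageOf p.2.1) :=
    (measurable_of_countable (shearAmp α)).comp hst
  have hint : Measurable fun p : SignSpace × ℝ × Space 2 =>
      interp (signOf ∘ fun k => p.1 (stageOf p.2.1, ⌊p.2.1 / blockLen α (stageOf p.2.1)⌋₊, k))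
        (p.2.2 (stageDir (stageOf p.2.1) + 1) / shearScale (stageOf p.2.1)) := by
    unfold interp
    refine ((measurable_const.sub hx.fract).mul ?_).add (hx.fract.mul ?_)
    · exact heval.comp (measurable_fst.prodMk (hst.prodMk (hbl.prodMk hfl)))
    · exact heval.comp (measurable_fst.prodMk (hst.prodMk (hbl.prodMk (hfl.add_const 1))))
  have hsingle : Measurable fun q : ℝ × ℕ =>
      (EuclideanSpace.single (stageDir q.2) q.1 : Space 2) :=
    measurable_from_prod_countable_left fun n =>
      (continuous_euclideanSpace_single (stageDir n)).measurable
  exact hsingle.comp ((hA.mul hint).prodMk hst)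

lemma memL1C0_velocity {α : ℝ} (hα : 0 ≤ α) (T : ℝ≥0) (ω : SignSpace) :
    MemL1C0 T (velocity α ω) := by
  have hmeas : StronglyMeasurable (velocity α ω) := by
    have h1 : StronglyMeasurable fun q : ℕ × ℕ =>
        shearField (stageDir q.1) (shearAmp α q.1) (shearScale q.1) fun k => ω (q.1, q.2, k) :=
      StronglyMeasurable.of_discrete
    exact h1.comp_measurable (measurable_stageOf.prodMk (measurable_blockIndex α))
  refine Measure.integrableOn_of_bounded (M := 1) (by simp) hmeas.aestronglyMeasurable ?_
  exact Filter.Eventually.of_forall fun t =>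
    (BoundedContinuousFunction.norm_le zero_le_one).2 (norm_velocity_apply_le hα ω t)

lemma isRandomVelocityField_velocity {α : ℝ} (hα : 0 ≤ α) (T : ℝ≥0) :
    IsRandomVelocityField T (velocity α) :=
  ⟨measurable_velocity α, memL1C0_velocity hα T⟩

end

noncomputable section

/-! ### Trajectories of the velocity field switched on at a positive time -/

/-- The increment of the driving path since time `0`, extended to the real line. -/
def noise (W : Path0 2 1) (s : ℝ) : Space 2 := IccExtend (1 : ℝ≥0).2 W s - W (startTime 1)

lemma continuous_noise (W : Path0 2 1) : Continuous (noise W) :=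
  (W.continuous.Icc_extend').sub continuous_const

lemma measurable_noise : Measurable fun p : Path0 2 1 × ℝ => noise p.1 p.2 := by
  have h : Continuous fun p : Path0 2 1 × ℝ => noise p.1 p.2 := by
    unfold noise IccExtend
    have h1 : Continuous fun p : Path0 2 1 × ℝ => projIcc (0 : ℝ) ((1 : ℝ≥0) : ℝ) (1 : ℝ≥0).2 p.2 :=
      continuous_projIcc.comp continuous_snd
    exact (ContinuousEval.continuous_eval.comp (continuous_fst.prodMk h1)).sub
      (ContinuousEval.continuous_eval.comp (continuous_fst.prodMk continuous_const))
  exact h.measurable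

lemma measurable_velocity_comp {β : Type*} [MeasurableSpace β] (α : ℝ) {f : β → SignSpace}
    {g : β → ℝ} {h : β → Space 2} (hf : Measurable f) (hg : Measurable g) (hh : Measurable h) :
    Measurable fun b => velocity α (f b) (g b) (h b) := by
  have hp : Measurable fun b => (f b, g b, h b) := hf.prodMk (hg.prodMk hh)
  have := (measurable_velocity α).comp hp
  simpa only [Function.comp_def] using this

/-- Picard iterates, in the frame moving with the noise, for the velocity field switched on at the
beginning of stage `m - 1`. -/
def picard (α : ℝ) (m : ℕ) (z : Space 2) (ω : SignSpace) (W : Path0 2 1) : ℕ → ℝ → Space 2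
  | 0, _ => z
  | k + 1, t => z + ∫ s in Ioc (stageTime m) t, velocity α ω s (picard α m z ω W k s + noise W s)

lemma measurable_picard (α : ℝ) (m : ℕ) (z : Space 2) (k : ℕ) :
    Measurable fun p : SignSpace × Path0 2 1 × ℝ => picard α m z p.1 p.2.1 k p.2.2 := by
  induction k with
  | zero => exact measurable_const
  | succ k ih =>
    simp only [picard]
    refine measurable_const.add ?_
    have hf : Measurable fun q : (SignSpace × Path0 2 1 × ℝ) × ℝ =>
        (Ioc (stageTime m) q.1.2.2).indicator (fun s => velocity α q.1.1 s
          (picard α m z q.1.1 q.1.2.1 k s + noise q.1.2.1 s)) q.2 := by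
      have hset : MeasurableSet {q : (SignSpace × Path0 2 1 × ℝ) × ℝ |
          stageTime m < q.2 ∧ q.2 ≤ q.1.2.2} :=
        (measurableSet_lt measurable_const measurable_snd).inter
          (measurableSet_le measurable_snd (by fun_prop))
      have hin : Measurable fun q : (SignSpace × Path0 2 1 × ℝ) × ℝ =>
          velocity α q.1.1 q.2 (picard α m z q.1.1 q.1.2.1 k q.2 + noise q.1.2.1 q.2) := by
        have h1 : Measurable fun q : (SignSpace × Path0 2 1 × ℝ) × ℝ =>
            picard α m z q.1.1 q.1.2.1 k q.2 :=
          ih.comp (show Measurable fun q : (SignSpace × Path0 2 1 × ℝ) × ℝ =>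
            (q.1.1, q.1.2.1, q.2) by fun_prop)
        have h2 : Measurable fun q : (SignSpace × Path0 2 1 × ℝ) × ℝ => noise q.1.2.1 q.2 :=
          measurable_noise.comp (show Measurable fun q : (SignSpace × Path0 2 1 × ℝ) × ℝ =>
            (q.1.2.1, q.2) by fun_prop)
        exact measurable_velocity_comp α (measurable_fst.comp measurable_fst) measurable_snd (h1.add h2)
      exact hin.indicator hset
    have h := (StronglyMeasurable.integral_prod_right' (ν := volume)
      hf.stronglyMeasurable).measurable
    simp_rw [integral_indicator measurableSet_Ioc] at h
    exact h

variable {α : ℝ} {m : ℕ} {z : Space 2} {ω : SignSpace} {W : Path0 2 1}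

lemma measurable_velocity_along (ω : SignSpace) {x : ℝ → Space 2} (hx : Measurable x) :
    Measurable fun s => velocity α ω s (x s) :=
  measurable_velocity_comp α measurable_const measurable_id hx

lemma integrableOn_velocity_along (hα : 0 ≤ α) (ω : SignSpace) {x : ℝ → Space 2}
    (hx : Measurable x) (a b : ℝ) : IntegrableOn (fun s => velocity α ω s (x s)) (Ioc a b) :=
  Measure.integrableOn_of_bounded (M := 1) (by simp)
    (measurable_velocity_along ω hx).aestronglyMeasurable
    (Filter.Eventually.of_forall fun _ => norm_velocity_apply_le hα ω _ _)

lemma measurable_picard_time (α : ℝ) (m : ℕ) (z : Space 2) (ω : SignSpace) (W : Path0 2 1) (k : ℕ) :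
    Measurable (picard α m z ω W k) :=
  (measurable_picard α m z k).comp (measurable_const.prodMk (measurable_const.prodMk measurable_id))

lemma measurable_picard_add_noise (α : ℝ) (m : ℕ) (z : Space 2) (ω : SignSpace) (W : Path0 2 1)
    (k : ℕ) : Measurable fun s => picard α m z ω W k s + noise W s :=
  (measurable_picard_time α m z ω W k).add (continuous_noise W).measurable

lemma setIntegral_apply {f : ℝ → Space 2} {s : Set ℝ} (hf : IntegrableOn f s) (c : Fin 2) :
    (∫ x in s, f x) c = ∫ x in s, f x c :=
  ((EuclideanSpace.proj c : Space 2 →L[ℝ] ℝ).integral_comp_comm hf).symm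

lemma velocity_apply_dir (α : ℝ) (ω : SignSpace) {n : ℕ} {s : ℝ}
    (hs : s ∈ Ioc (stageTime (n + 1)) (stageTime n)) (x : Space 2) :
    velocity α ω s x (stageDir n) = shearAmp α n *
      interp (signOf ∘ fun k => ω (n, ⌊s / blockLen α n⌋₊, k))
        (x (stageDir n + 1) / shearScale n) := by
  unfold velocity
  rw [stageOf_eq hs.1 hs.2, shearField_apply]
  simp

lemma velocity_apply_transverse (α : ℝ) (ω : SignSpace) {n : ℕ} {s : ℝ}
    (hs : s ∈ Ioc (stageTime (n + 1)) (stageTime n)) (x : Space 2) :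
    velocity α ω s x (stageDir n + 1) = 0 := by
  unfold velocity
  rw [stageOf_eq hs.1 hs.2, shearField_apply]
  simp

lemma velocity_congr (α : ℝ) (ω : SignSpace) {n : ℕ} {s : ℝ}
    (hs : s ∈ Ioc (stageTime (n + 1)) (stageTime n)) {x x' : Space 2}
    (h : x (stageDir n + 1) = x' (stageDir n + 1)) : velocity α ω s x = velocity α ω s x' := by
  unfold velocity
  rw [stageOf_eq hs.1 hs.2, shearField_apply, shearField_apply, h]

lemma stageTime_antitone : Antitone stageTime := fun _ _ h =>
  pow_le_pow_of_le_one (by norm_num) (by norm_num) h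

lemma picard_succ_eq_add (hα : 0 ≤ α) (k : ℕ) {a b : ℝ} (ha : stageTime m ≤ a) (hab : a ≤ b) :
    picard α m z ω W (k + 1) b = picard α m z ω W (k + 1) a +
      ∫ s in Ioc a b, velocity α ω s (picard α m z ω W k s + noise W s) := by
  have hx := measurable_picard_add_noise α m z ω W k
  simp only [picard]
  rw [add_assoc, ← setIntegral_union (Set.Ioc_disjoint_Ioc_of_le le_rfl) measurableSet_Ioc
    (integrableOn_velocity_along hα ω hx _ _) (integrableOn_velocity_along hα ω hx _ _),
    Ioc_union_Ioc_eq_Ioc ha hab]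

lemma picard_transverse (hα : 0 ≤ α) (k : ℕ) {n : ℕ} (hn : n < m) {s : ℝ}
    (hs : s ∈ Icc (stageTime (n + 1)) (stageTime n)) :
    picard α m z ω W k s (stageDir n + 1) =
      picard α m z ω W k (stageTime (n + 1)) (stageDir n + 1) := by
  cases k with
  | zero => rfl
  | succ k =>
    rw [picard_succ_eq_add hα k (stageTime_antitone hn) hs.1, PiLp.add_apply, setIntegral_apply
      (integrableOn_velocity_along hα ω (measurable_picard_add_noise α m z ω W k) _ _),
      setIntegral_eq_zero_of_forall_eq_zero, add_zero]
    exact fun r hr => velocity_apply_transverse α ω ⟨hr.1, hr.2.trans hs.2⟩ _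

lemma picard_of_le (k : ℕ) {t : ℝ} (ht : t ≤ stageTime m) : picard α m z ω W k t = z := by
  cases k with
  | zero => rfl
  | succ k => simp [picard, Ioc_eq_empty (not_lt.2 ht)]

/-- Each Picard iteration is exact for one more stage. -/
lemma picard_succ_eq (hα : 0 ≤ α) (k : ℕ) : ∀ {n : ℕ}, m ≤ n + k → ∀ {t : ℝ}, t ≤ stageTime n →
    picard α m z ω W (k + 1) t = picard α m z ω W k t := by
  induction k with
  | zero =>
    intro n hn t ht
    rw [picard_of_le 1 (ht.trans (stageTime_antitone hn)), picard_of_le 0 (ht.trans (stageTime_antitone hn))]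
  | succ k ih =>
    intro n hn t ht
    have key : ∀ s ∈ Ioc (stageTime m) t,
        velocity α ω s (picard α m z ω W (k + 1) s + noise W s) =
          velocity α ω s (picard α m z ω W k s + noise W s) := by
      intro s hs
      by_cases h : s ≤ stageTime (n + 1)
      · rw [ih (n := n + 1) (by omega) h]
      · have hs' : s ∈ Ioc (stageTime (n + 1)) (stageTime n) := ⟨not_le.1 h, hs.2.trans ht⟩
        have hnm : n < m := by
          by_contra hcon
          exact absurd (hs.1.trans_le hs'.2) (not_lt.2 (stageTime_antitone (not_lt.1 hcon)))
        refine velocity_congr α ω hs' ?_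
        rw [PiLp.add_apply, PiLp.add_apply, picard_transverse hα _ hnm ⟨hs'.1.le, hs'.2⟩,
          picard_transverse hα _ hnm ⟨hs'.1.le, hs'.2⟩, ih (n := n + 1) (by omega) le_rfl]
    rw [picard, setIntegral_congr_fun measurableSet_Ioc key]
    rfl

lemma picard_congr_signs {ω' : SignSpace} {n : ℕ}
    (h : ∀ n' ≥ n, ∀ j k, ω (n', j, k) = ω' (n', j, k)) (k : ℕ) :
    ∀ {t : ℝ}, t ≤ stageTime n → picard α m z ω W k t = picard α m z ω' W k t := by
  induction k with
  | zero => intros; rfl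
  | succ k ih =>
    intro t ht
    simp only [picard]
    congr 1
    refine setIntegral_congr_fun measurableSet_Ioc fun s hs => ?_
    have hs0 : 0 < s := (stageTime_pos m).trans hs.1
    have hst := le_stageOf hs0 (hs.2.trans ht)
    simp only [ih (hs.2.trans ht), velocity, h _ hst]

/-- The trajectory, in the frame moving with the noise, starting from `z` with the velocity field
switched on at the beginning of stage `m - 1`. -/
def trajectory (α : ℝ) (m : ℕ) (z : Space 2) (ω : SignSpace) (W : Path0 2 1) (t : ℝ) : Space 2 :=
  picard α m z ω W m t

lemma trajectory_of_le {t : ℝ} (ht : t ≤ stageTime m) : trajectory α m z ω W t = z :=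
  picard_of_le m ht

lemma measurable_trajectory (α : ℝ) (m : ℕ) (z : Space 2) :
    Measurable fun p : SignSpace × Path0 2 1 × ℝ => trajectory α m z p.1 p.2.1 p.2.2 :=
  measurable_picard α m z m

lemma measurable_trajectory_add_noise (α : ℝ) (m : ℕ) (z : Space 2) (ω : SignSpace) (W : Path0 2 1) :
    Measurable fun s => trajectory α m z ω W s + noise W s :=
  measurable_picard_add_noise α m z ω W m

lemma trajectory_eq (hα : 0 ≤ α) {t : ℝ} (ht : t ≤ 1) :
    trajectory α m z ω W t =
      z + ∫ s in Ioc (stageTime m) t, velocity α ω s (trajectory α m z ω W s + noise W s) := by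
  have h0 : t ≤ stageTime 0 := by simpa [stageTime] using ht
  rw [trajectory, ← picard_succ_eq hα m (n := 0) (by omega) h0, picard]
  rfl

lemma trajectory_eq_add (hα : 0 ≤ α) {a b : ℝ} (ha : stageTime m ≤ a) (hab : a ≤ b) (hb : b ≤ 1) :
    trajectory α m z ω W b = trajectory α m z ω W a +
      ∫ s in Ioc a b, velocity α ω s (trajectory α m z ω W s + noise W s) := by
  have h0 : b ≤ stageTime 0 := by simpa [stageTime] using hb
  rw [trajectory, ← picard_succ_eq hα m (n := 0) (by omega) h0, picard_succ_eq_add hα m ha hab,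
    picard_succ_eq hα m (n := 0) (by omega) (hab.trans h0)]
  rfl

lemma trajectory_congr_signs {ω' : SignSpace} {n : ℕ}
    (h : ∀ n' ≥ n, ∀ j k, ω (n', j, k) = ω' (n', j, k)) {t : ℝ} (ht : t ≤ stageTime n) :
    trajectory α m z ω W t = trajectory α m z ω' W t :=
  picard_congr_signs h m ht

/-- The beginning of the `i`-th time block of stage `n`. -/
def blockStart (α : ℝ) (n i : ℕ) : ℝ := (numBlocks α n + i) * blockLen α n

lemma blockStart_zero (α : ℝ) (n : ℕ) : blockStart α n 0 = stageTime (n + 1) := by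
  rw [← numBlocks_mul_blockLen α, blockStart]; simp

lemma blockStart_numBlocks (α : ℝ) (n : ℕ) : blockStart α n (numBlocks α n) = stageTime n := by
  have := numBlocks_mul_blockLen α n
  rw [stageTime_succ] at this
  rw [blockStart, add_mul, this]; ring

lemma blockStart_succ (α : ℝ) (n i : ℕ) :
    blockStart α n (i + 1) = blockStart α n i + blockLen α n := by
  unfold blockStart; push_cast; ring

lemma blockStart_mono (α : ℝ) (n : ℕ) : Monotone (blockStart α n) :=
  monotone_nat_of_le_succ fun i => by
    rw [blockStart_succ]; linarith [blockLen_pos α n]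

lemma stageTime_le_one (n : ℕ) : stageTime n ≤ 1 := pow_le_one₀ (by norm_num) (by norm_num)

lemma block_subset {n i : ℕ} (hi : i < numBlocks α n) :
    Icc (blockStart α n i) (blockStart α n (i + 1)) ⊆ Icc (stageTime (n + 1)) (stageTime n) := by
  rw [← blockStart_zero α n, ← blockStart_numBlocks α n]
  exact Icc_subset_Icc (blockStart_mono α n (Nat.zero_le _)) (blockStart_mono α n hi)

lemma blockIndex_eq {n i : ℕ} {s : ℝ} (hs : s ∈ Ico (blockStart α n i) (blockStart α n (i + 1))) :
    ⌊s / blockLen α n⌋₊ = numBlocks α n + i := by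
  have h0 := blockLen_pos α n
  have hs0 : 0 ≤ s / blockLen α n :=
    div_nonneg ((by unfold blockStart; positivity : 0 ≤ blockStart α n i).trans hs.1) h0.le
  rw [Nat.floor_eq_iff hs0, le_div_iff₀ h0, div_lt_iff₀ h0]
  refine ⟨?_, ?_⟩
  · simpa [blockStart] using hs.1
  · simpa [blockStart, add_assoc] using hs.2

/-- The displacement produced during the `i`-th time block of stage `n` when the transverse
coordinate is `x`, up to the amplitude. -/
def blockIntegral (α : ℝ) (ω : SignSpace) (W : Path0 2 1) (n i : ℕ) (x : ℝ) : ℝ :=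
  ∫ s in blockStart α n i..blockStart α n (i + 1),
    interp (signOf ∘ fun k => ω (n, numBlocks α n + i, k))
      ((x + noise W s (stageDir n + 1)) / shearScale n)

lemma trajectory_dir (hα : 0 ≤ α) {n : ℕ} (hn : n < m) :
    trajectory α m z ω W (stageTime n) (stageDir n) =
      trajectory α m z ω W (stageTime (n + 1)) (stageDir n) +
      ∑ i ∈ Finset.range (numBlocks α n), shearAmp α n * blockIntegral α ω W n i
        (trajectory α m z ω W (stageTime (n + 1)) (stageDir n + 1)) := by
  have hmn := stageTime_antitone hn
  have hle := stageTime_antitone (Nat.le_succ n)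
  have hint := fun a b => integrableOn_velocity_along hα ω
    (measurable_trajectory_add_noise α m z ω W) a b
  have hint' : ∀ a b, IntegrableOn (fun s => velocity α ω s
      (trajectory α m z ω W s + noise W s) (stageDir n)) (Ioc a b) := fun a b =>
    (EuclideanSpace.proj (stageDir n) : Space 2 →L[ℝ] ℝ).integrable_comp (hint a b)
  rw [trajectory_eq_add hα hmn hle (stageTime_le_one n), PiLp.add_apply,
    setIntegral_apply (hint _ _), ← intervalIntegral.integral_of_le hle]
  congr 1
  rw [← blockStart_zero α n, ← blockStart_numBlocks α n,
    ← intervalIntegral.sum_integral_adjacent_intervals]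
  · refine Finset.sum_congr rfl fun i hi => ?_
    have hile := blockStart_mono α n (Nat.le_succ i)
    rw [blockIntegral, ← intervalIntegral.integral_const_mul, intervalIntegral.integral_of_le hile,
      intervalIntegral.integral_of_le hile, integral_Ioc_eq_integral_Ioo,
      integral_Ioc_eq_integral_Ioo]
    refine setIntegral_congr_fun measurableSet_Ioo fun s hs => ?_
    have hsub := block_subset (α := α) (Finset.mem_range.1 hi)
    have hsI : s ∈ Ioc (stageTime (n + 1)) (stageTime n) :=
      ⟨(hsub ⟨le_rfl, hile⟩).1.trans_lt hs.1, (hsub ⟨hs.1.le, hs.2.le⟩).2⟩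
    simp only []
    rw [velocity_apply_dir α ω hsI, blockIndex_eq ⟨hs.1.le, hs.2⟩, PiLp.add_apply, blockStart_zero]
    have : trajectory α m z ω W s (stageDir n + 1) =
        trajectory α m z ω W (stageTime (n + 1)) (stageDir n + 1) :=
      picard_transverse hα m hn ⟨hsI.1.le, hsI.2⟩
    rw [this]
  · intro i _
    rw [intervalIntegrable_iff_integrableOn_Ioc_of_le (blockStart_mono α n (Nat.le_succ i))]
    exact hint' _ _

end

noncomputable section

lemma unitTime_le_one (t : Icc (0 : ℝ) (1 : ℝ≥0)) : (t : ℝ) ≤ 1 := t.2.2.trans_eq NNReal.coe_one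

lemma IccExtend_path {d : ℕ} {T : ℝ≥0} {f : Icc (0 : ℝ) T → Space d} {s : ℝ}
    (hs : s ∈ Icc (0 : ℝ) T) : IccExtend T.2 f s = f ⟨s, hs⟩ :=
  IccExtend_of_mem T.2 f hs

/-! ### Limits of trajectories are Carathéodory solutions -/

section Limits

open Filter Topology

variable {α : ℝ} {m : ℕ} {y z : Space 2} {ω : SignSpace} {W : Path0 2 1}

lemma norm_setIntegral_velocity_le (hα : 0 ≤ α) (ω : SignSpace) (x : ℝ → Space 2) {a b : ℝ}
    (hab : a ≤ b) : ‖∫ s in Ioc a b, velocity α ω s (x s)‖ ≤ b - a := by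
  have h := norm_setIntegral_le_of_norm_le_const (μ := volume) (s := Ioc a b) (C := 1)
    (f := fun s => velocity α ω s (x s)) (by simp)
    (fun s _ => norm_velocity_apply_le hα ω s (x s))
  simpa [Measure.real, Real.volume_Ioc, ENNReal.toReal_ofReal (sub_nonneg.2 hab)] using h

lemma norm_trajectory_sub_le (hα : 0 ≤ α) {a b : ℝ} (hab : a ≤ b) (hb : b ≤ 1) :
    ‖trajectory α m z ω W b - trajectory α m z ω W a‖ ≤ b - a := by
  have hmain : ∀ a', stageTime m ≤ a' → a' ≤ b →
      ‖trajectory α m z ω W b - trajectory α m z ω W a'‖ ≤ b - a' := fun a' h1 h2 => by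
    rw [trajectory_eq_add hα h1 h2 hb, add_sub_cancel_left]
    exact norm_setIntegral_velocity_le hα ω _ h2
  rcases le_total (stageTime m) a with h | h
  · exact hmain a h hab
  · rw [trajectory_of_le h]
    rcases le_total (stageTime m) b with h' | h'
    · have := hmain _ le_rfl h'
      rw [trajectory_of_le le_rfl] at this
      linarith
    · rw [trajectory_of_le h', sub_self, norm_zero]; linarith

lemma lipschitzWith_trajectory (hα : 0 ≤ α) (m : ℕ) (z : Space 2) (ω : SignSpace) (W : Path0 2 1) :
    LipschitzWith 1 fun t : Icc (0 : ℝ) (1 : ℝ≥0) => trajectory α m z ω W t := by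
  refine LipschitzWith.mk_one fun a b => ?_
  rw [Subtype.dist_eq, Real.dist_eq, dist_eq_norm]
  rcases le_total (a : ℝ) b with h | h
  · rw [norm_sub_rev, abs_sub_comm, abs_of_nonneg (sub_nonneg.2 h)]
    exact norm_trajectory_sub_le hα h (unitTime_le_one b)
  · rw [abs_of_nonneg (sub_nonneg.2 h)]
    exact norm_trajectory_sub_le hα h (unitTime_le_one a)

lemma norm_trajectory_sub_start_le (hα : 0 ≤ α) (t : Icc (0 : ℝ) (1 : ℝ≥0)) :
    ‖trajectory α m z ω W t - z‖ ≤ 1 := by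
  have h := norm_trajectory_sub_le (m := m) (z := z) (ω := ω) (W := W) hα t.2.1 (unitTime_le_one t)
  rw [trajectory_of_le (stageTime_pos m).le] at h
  linarith [unitTime_le_one t]

lemma tendsto_stageTime : Tendsto stageTime atTop (𝓝 0) :=
  tendsto_pow_atTop_nhds_zero_of_lt_one (by norm_num) (by norm_num)

lemma eq_add_integral_of_tendsto_trajectory (hα : 0 ≤ α) {φ : ℕ → ℕ} (hφ : Tendsto φ atTop atTop)
    {z : ℕ → Space 2} (hz : Tendsto z atTop (𝓝 y)) {x : ℝ → Space 2}
    (hx : ∀ t ∈ Icc (0 : ℝ) 1,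
      Tendsto (fun j => trajectory α (φ j) (z j) ω W t) atTop (𝓝 (x t)))
    {t : ℝ} (ht : t ∈ Icc (0 : ℝ) 1) :
    x t = y + ∫ s in Ioc 0 t, velocity α ω s (x s + noise W s) := by
  refine tendsto_nhds_unique (hx t ht) ?_
  have heq : ∀ j, trajectory α (φ j) (z j) ω W t = z j + ∫ s in Ioc 0 t,
      (Ioi (stageTime (φ j))).indicator (fun s => velocity α ω s
        (trajectory α (φ j) (z j) ω W s + noise W s)) s := fun j => by
    rw [trajectory_eq hα ht.2, setIntegral_indicator measurableSet_Ioi]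
    congr 3
    ext s
    have := stageTime_pos (φ j)
    simp only [mem_Ioc, mem_inter_iff, mem_Ioi]
    constructor
    · rintro ⟨h1, h2⟩; exact ⟨⟨this.trans h1, h2⟩, h1⟩
    · rintro ⟨⟨_, h2⟩, h3⟩; exact ⟨h3, h2⟩
  simp_rw [heq]
  refine hz.add (tendsto_integral_of_dominated_convergence (fun _ => 1) (fun j => ?_) ?_ ?_ ?_)
  · exact ((measurable_velocity_along ω
      (measurable_trajectory_add_noise α _ _ ω W)).indicator measurableSet_Ioi).aestronglyMeasurable
  · exact integrable_const _
  · exact fun j => Eventually.of_forall fun s =>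
      (norm_indicator_le_norm_self _ _).trans (norm_velocity_apply_le hα _ _ _)
  · refine (ae_restrict_mem measurableSet_Ioc).mono fun s hs => ?_
    have hlim : Tendsto (fun j => velocity α ω s (trajectory α (φ j) (z j) ω W s + noise W s)) atTop
        (𝓝 (velocity α ω s (x s + noise W s))) :=
      ((velocity α ω s).continuous.tendsto _).comp
        ((hx s ⟨hs.1.le, hs.2.trans ht.2⟩).add tendsto_const_nhds)
    refine hlim.congr' ?_
    filter_upwards [(tendsto_stageTime.comp hφ).eventually (gt_mem_nhds hs.1)] with j hj
    symm
    exact indicator_of_mem (mem_Ioi.2 hj) _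

/-- The perturbed starting point of the second trajectory. -/
def offsetStart (y : Space 2) (m : ℕ) : Space 2 :=
  y + EuclideanSpace.single (stageDir m) (gapScale m)

lemma gapScale_le_one (n : ℕ) : gapScale n ≤ 1 := pow_le_one₀ (by norm_num) (by norm_num)

lemma norm_offsetStart_sub (y : Space 2) (m : ℕ) : ‖offsetStart y m - y‖ = gapScale m := by
  rw [offsetStart, add_sub_cancel_left, PiLp.norm_single, Real.norm_eq_abs,
    abs_of_pos (gapScale_pos m)]

lemma gapScale_le (n : ℕ) : gapScale n ≤ stageTime n :=
  pow_le_pow_of_le_one (by norm_num) (by norm_num) (Nat.le_self_pow (by norm_num) n)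

lemma tendsto_offsetStart (y : Space 2) : Tendsto (offsetStart y) atTop (𝓝 y) := by
  rw [tendsto_iff_norm_sub_tendsto_zero]
  simp_rw [norm_offsetStart_sub]
  exact squeeze_zero (fun n => (gapScale_pos n).le) gapScale_le tendsto_stageTime

/-- The two trajectories switched on at the beginning of stage `m - 1` are well separated at the end
of stage `n`. -/
def Separated (α : ℝ) (y : Space 2) (m n : ℕ) (ω : SignSpace) (W : Path0 2 1) : Prop :=
  gapScale n ≤ |trajectory α m y ω W (stageTime n) (stageDir n) -
    trajectory α m (offsetStart y m) ω W (stageTime n) (stageDir n)|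

lemma exists_limit_pair (hα : 0 ≤ α) {n : ℕ} (h : ∃ᶠ m in atTop, Separated α y m n ω W) :
    ∃ f g : Path0 2 1,
      (∀ t : Icc (0 : ℝ) (1 : ℝ≥0), f t = y + ∫ s in Ioc 0 (t : ℝ),
        velocity α ω s (IccExtend (1 : ℝ≥0).2 f s + noise W s)) ∧
      (∀ t : Icc (0 : ℝ) (1 : ℝ≥0), g t = y + ∫ s in Ioc 0 (t : ℝ),
        velocity α ω s (IccExtend (1 : ℝ≥0).2 g s + noise W s)) ∧
      ∀ t : Icc (0 : ℝ) (1 : ℝ≥0), (t : ℝ) = stageTime n → f t ≠ g t := by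
  obtain ⟨ψ, hψ, hsep⟩ := extraction_of_frequently_atTop h
  set A : Set (Icc (0 : ℝ) (1 : ℝ≥0) →ᵇ Space 2) := {f | LipschitzWith 1 f ∧ ∀ t, f t ∈ Metric.closedBall y 2}
    with hA
  have hcomp : IsCompact (closure A) :=
    BoundedContinuousFunction.arzela_ascoli (Metric.closedBall y 2) (isCompact_closedBall y 2) A
      (fun f t hf => hf.2 t)
      (LipschitzWith.uniformEquicontinuous _ 1 fun f : A => f.2.1).equicontinuous
  have hball : ∀ m z, ‖z - y‖ ≤ 1 → ∀ t : Icc (0 : ℝ) (1 : ℝ≥0),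
      trajectory α m z ω W t ∈ Metric.closedBall y 2 := fun m z hz t => by
    rw [mem_closedBall_iff_norm]
    have := norm_add_le (trajectory α m z ω W t - z) (z - y)
    rw [sub_add_sub_cancel] at this
    linarith [norm_trajectory_sub_start_le (m := m) (z := z) (ω := ω) (W := W) hα t]
  have hmk : ∀ m z, ‖z - y‖ ≤ 1 → ∃ f ∈ A, ∀ t : Icc (0 : ℝ) (1 : ℝ≥0), f t = trajectory α m z ω W t :=
    fun m z hz => ⟨BoundedContinuousFunction.mkOfCompact
      ⟨_, (lipschitzWith_trajectory hα m z ω W).continuous⟩,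
      ⟨lipschitzWith_trajectory hα m z ω W, hball m z hz⟩, fun _ => rfl⟩
  choose f hfA hf using fun j => hmk (ψ j) y (by simp)
  choose g hgA hg using fun j => hmk (ψ j) (offsetStart y (ψ j))
    (by rw [norm_offsetStart_sub]; exact gapScale_le_one _)
  obtain ⟨⟨F, G⟩, -, θ, hθ, hlim⟩ := (hcomp.prod hcomp).tendsto_subseq
    (x := fun j => (f j, g j)) fun j => ⟨subset_closure (hfA j), subset_closure (hgA j)⟩
  have hφ : Tendsto (ψ ∘ θ) atTop atTop := hψ.tendsto_atTop.comp hθ.tendsto_atTop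
  have hF : ∀ t : Icc (0 : ℝ) (1 : ℝ≥0),
      Tendsto (fun j => trajectory α (ψ (θ j)) y ω W t) atTop (𝓝 (F t)) := fun t => by
    simp_rw [← hf]
    exact ((continuous_eval_const t).tendsto F).comp
      (hlim.fst_nhds)
  have hG : ∀ t : Icc (0 : ℝ) (1 : ℝ≥0), Tendsto (fun j => trajectory α (ψ (θ j))
      (offsetStart y (ψ (θ j))) ω W t) atTop (𝓝 (G t)) := fun t => by
    simp_rw [← hg]
    exact ((continuous_eval_const t).tendsto G).comp
      (hlim.snd_nhds)
  refine ⟨F.toContinuousMap, G.toContinuousMap, fun t => ?_, fun t => ?_, fun t ht heq => ?_⟩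
  · have := eq_add_integral_of_tendsto_trajectory (ω := ω) (W := W) hα hφ
      (tendsto_const_nhds (x := y)) (x := IccExtend (1 : ℝ≥0).2 F)
      (fun t ht => by rw [IccExtend_path (by simpa using ht)]; exact hF _) ⟨t.2.1, unitTime_le_one t⟩
    rwa [IccExtend_path t.2] at this
  · have := eq_add_integral_of_tendsto_trajectory (ω := ω) (W := W) hα hφ
      ((tendsto_offsetStart y).comp hφ) (x := IccExtend (1 : ℝ≥0).2 G)
      (fun t ht => by rw [IccExtend_path (by simpa using ht)]; exact hG _) ⟨t.2.1, unitTime_le_one t⟩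
    rwa [IccExtend_path t.2] at this
  · have hc : Continuous fun p : Space 2 × Space 2 => |p.1 (stageDir n) - p.2 (stageDir n)| := by
      fun_prop
    have hlim2 := (hc.tendsto (F t, G t)).comp ((hF t).prodMk_nhds (hG t))
    have hle : gapScale n ≤ |F t (stageDir n) - G t (stageDir n)| :=
      ge_of_tendsto' hlim2 fun j => by
        have := hsep (θ j)
        rw [Separated, ← ht] at this
        exact this
    have heq' : F t = G t := heq
    rw [heq', sub_self, abs_zero] at hle
    exact absurd hle (not_le.2 (gapScale_pos n))

end Limits

lemma isCaratheodorySolution_add_noise {u : ℝ → (Space 2 →ᵇ Space 2)} {y : Space 2} {W : Path0 2 1}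
    {f : Path0 2 1}
    (hf : ∀ t : Icc (0 : ℝ) (1 : ℝ≥0), f t = y + ∫ s in Ioc 0 (t : ℝ),
      u s (IccExtend (1 : ℝ≥0).2 f s + noise W s)) :
    IsCaratheodorySolution (T := 1) u y W (f + W - ContinuousMap.const _ (W (startTime 1))) := by
  intro t
  have h := hf t
  have hnoise : ∀ s ∈ Ioc (0 : ℝ) t, IccExtend (1 : ℝ≥0).2
      (f + W - ContinuousMap.const _ (W (startTime 1)) : Path0 2 1) s =
        IccExtend (1 : ℝ≥0).2 f s + noise W s := fun s hs => by
    simp only [noise, IccExtend, Function.comp]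
    rw [add_sub_assoc]; rfl
  rw [intervalIntegral.integral_of_le t.2.1, setIntegral_congr_fun measurableSet_Ioc
    fun s hs => congrArg (u s) (hnoise s hs), ← h]
  rfl

lemma isCaratheodorySolution_restrictPath {d : ℕ} {T ε : ℝ≥0} (h : ε ≤ T)
    {u : ℝ → (Space d →ᵇ Space d)} {y : Space d} {W X : Path0 d T}
    (hX : IsCaratheodorySolution u y W X) :
    IsCaratheodorySolution u y (restrictPath h W) (restrictPath h X) := by
  intro t
  have ht := hX (inclusion (Icc_subset_Icc_right (NNReal.coe_le_coe.mpr h)) t)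
  have hcongr : ∀ s ∈ Ioc (0 : ℝ) t, u s (IccExtend ε.2 (restrictPath h X) s) =
      u s (IccExtend T.2 X s) := fun s hs => by
    have h1 : s ∈ Icc (0 : ℝ) ε := ⟨hs.1.le, hs.2.trans t.2.2⟩
    have h2 : s ∈ Icc (0 : ℝ) T := Icc_subset_Icc_right (NNReal.coe_le_coe.mpr h) h1
    rw [IccExtend_path h1, IccExtend_path h2]; rfl
  rw [intervalIntegral.integral_of_le t.2.1, setIntegral_congr_fun measurableSet_Ioc hcongr,
    ← intervalIntegral.integral_of_le t.2.1]
  exact ht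

/-- Separation at infinitely many scales, for infinitely many switching times, prevents uniqueness
on every time interval. -/
lemma hasNonuniqueSolutions_of_frequently_separated {α : ℝ} (hα : 0 ≤ α) {y : Space 2}
    {ω : SignSpace} {W : Path0 2 1}
    (h : ∃ᶠ n in Filter.atTop, ∃ᶠ m in Filter.atTop, Separated α y m n ω W)
    {ε : ℝ≥0} (hε : ε ≤ 1) (hε0 : 0 < ε) :
    HasNonuniqueSolutions (velocity α ω) y (restrictPath hε W) := by
  obtain ⟨n, hn, hnε⟩ := (h.and_eventually (tendsto_stageTime.eventually
    (gt_mem_nhds (NNReal.coe_pos.2 hε0)))).exists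
  obtain ⟨f, g, hf, hg, hfg⟩ := exists_limit_pair hα hn
  refine ⟨_, _, isCaratheodorySolution_restrictPath hε (isCaratheodorySolution_add_noise hf),
    isCaratheodorySolution_restrictPath hε (isCaratheodorySolution_add_noise hg), fun heq => ?_⟩
  have := DFunLike.congr_fun heq (⟨stageTime n, (stageTime_pos n).le, hnε.le⟩ : Icc (0 : ℝ) ε)
  have h1 : stageTime n ∈ Icc (0 : ℝ) (1 : ℝ≥0) := ⟨(stageTime_pos n).le, stageTime_le_one n⟩
  refine hfg ⟨stageTime n, h1⟩ rfl ?_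
  change f ⟨stageTime n, h1⟩ + W _ - W _ = g ⟨stageTime n, h1⟩ + W _ - W _ at this
  exact add_right_cancel (sub_left_injective this)

end

noncomputable section

/-! ### Separation is propagated from one stage to the next -/

variable {α : ℝ} {m n : ℕ} {y : Space 2} {ω : SignSpace} {W : Path0 2 1}

/-- On average, the noise moves by much less than the length scale of stage `n` during each of the
time blocks of that stage. -/
def RegularAt (α : ℝ) (n : ℕ) (W : Path0 2 1) : Prop :=
  ∀ i < numBlocks α n, ∫ s in blockStart α n i..blockStart α n (i + 1),
    |noise W s (stageDir n + 1) - noise W (blockStart α n i) (stageDir n + 1)| ≤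
      blockLen α n * shearScale n / 8

/-- The node of the profile that is nearest to a trajectory with transverse coordinate `x` at the
beginning of a time block. -/
def nearestNode (α : ℝ) (W : Path0 2 1) (n i : ℕ) (x : ℝ) : ℤ :=
  round ((x + noise W (blockStart α n i) (stageDir n + 1)) / shearScale n)

/-- The time that a trajectory with transverse coordinate `x` spends near the node `κ` during a time
block. -/
def nodeTime (α : ℝ) (W : Path0 2 1) (n i : ℕ) (κ : ℤ) (x : ℝ) : ℝ :=
  ∫ s in blockStart α n i..blockStart α n (i + 1),
    tent ((x + noise W s (stageDir n + 1)) / shearScale n - κ)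

lemma continuous_noise_apply (W : Path0 2 1) (c : Fin 2) : Continuous fun s => noise W s c := by
  have := continuous_noise W
  fun_prop

lemma blockIntegral_sub_of_eq_off {ω ω' : SignSpace} {i : ℕ} {κ : ℤ}
    (h : ∀ k, k ≠ κ → ω' (n, numBlocks α n + i, k) = ω (n, numBlocks α n + i, k)) (x : ℝ) :
    blockIntegral α ω' W n i x - blockIntegral α ω W n i x =
      (signOf (ω' (n, numBlocks α n + i, κ)) - signOf (ω (n, numBlocks α n + i, κ))) *
        nodeTime α W n i κ x := by
  have hw := continuous_noise_apply W (stageDir n + 1)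
  have hint : ∀ ω'' : SignSpace, IntervalIntegrable (fun s =>
      interp (signOf ∘ fun k => ω'' (n, numBlocks α n + i, k))
        ((x + noise W s (stageDir n + 1)) / shearScale n)) volume
      (blockStart α n i) (blockStart α n (i + 1)) := fun ω'' =>
    ((continuous_interp (abs_signOf_comp_le _)).comp
      ((continuous_const.add hw).div_const _)).intervalIntegrable _ _
  unfold blockIntegral nodeTime
  rw [← intervalIntegral.integral_sub (hint _) (hint _), ← intervalIntegral.integral_const_mul]
  refine intervalIntegral.integral_congr fun s _ => ?_
  exact interp_sub_interp_of_eq_off (fun k hk => by simp [h k hk]) _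

lemma le_tent_sub_tent {p q : ℝ} (d : ℝ) (hp : |p| ≤ 1 / 2) (hpq : 2 ≤ |q - p|) :
    1 / 2 - 2 * |d| ≤ tent (p + d) - tent (q + d) := by
  have h1 : |p + d| ≤ 1 / 2 + |d| := (abs_add_le _ _).trans (by linarith)
  have h2 : 3 / 2 - |d| ≤ |q + d| := by
    have := abs_sub (q + d) (p + d)
    rw [show q + d - (p + d) = q - p by ring] at this
    linarith
  have t1 : 1 / 2 - |d| ≤ tent (p + d) := le_trans (by linarith) (le_max_right _ _)
  have t2 : tent (q + d) ≤ |d| := max_le (abs_nonneg _) (by linarith)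
  linarith

lemma le_nodeTime_sub {i : ℕ} (hi : i < numBlocks α n) (hreg : RegularAt α n W) {x x' : ℝ}
    (hxx' : gapScale (n + 1) ≤ |x - x'|) :
    blockLen α n / 4 ≤ nodeTime α W n i (nearestNode α W n i x) x -
      nodeTime α W n i (nearestNode α W n i x) x' := by
  have hw := continuous_noise_apply W (stageDir n + 1)
  have hl := shearScale_pos n
  have hr : |(x + noise W (blockStart α n i) (stageDir n + 1)) / shearScale n -
      nearestNode α W n i x| ≤ 1 / 2 := abs_sub_round _
  have hR := hreg i hi
  have hle : blockStart α n i ≤ blockStart α n (i + 1) := blockStart_mono α n (Nat.le_succ i)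
  have hlen := blockStart_succ α n i
  have hsep : 2 ≤ |(x' - x) / shearScale n| := by
    rw [abs_div, abs_of_pos hl, le_div_iff₀ hl, abs_sub_comm, ← gapScale_succ]
    exact hxx'
  unfold nodeTime
  generalize nearestNode α W n i x = κ at *
  generalize stageDir n + 1 = c at *
  generalize blockStart α n (i + 1) = t₁ at *
  generalize blockStart α n i = t₀ at *
  generalize shearScale n = l at *
  generalize blockLen α n = τ at *
  have hint : ∀ x'' : ℝ, IntervalIntegrable (fun s => tent ((x'' + noise W s c) / l - κ)) volume
      t₀ t₁ := fun x'' => (continuous_tent.comp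
        (((continuous_const.add hw).div_const l).sub continuous_const)).intervalIntegrable _ _
  have hD : IntervalIntegrable (fun s => |noise W s c - noise W t₀ c|) volume t₀ t₁ :=
    (hw.sub continuous_const).abs.intervalIntegrable _ _
  have hpt : ∀ s, 1 / 2 - 2 / l * |noise W s c - noise W t₀ c| ≤
      tent ((x + noise W s c) / l - κ) - tent ((x' + noise W s c) / l - κ) := by
    intro s
    have h := le_tent_sub_tent (q := (x' + noise W t₀ c) / l - κ)
      ((noise W s c - noise W t₀ c) / l) hr (by convert hsep using 2; ring)
    rw [abs_div, abs_of_pos hl] at h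
    convert h using 2
    · ring
    · congr 1; ring
    · congr 1; ring
  have hmono := intervalIntegral.integral_mono_on hle
    ((intervalIntegrable_const (c := (1 / 2 : ℝ))).sub (hD.const_mul (2 / l)))
    ((hint x).sub (hint x')) fun s _ => hpt s
  rw [intervalIntegral.integral_sub intervalIntegrable_const (hD.const_mul _),
    intervalIntegral.integral_sub (hint x) (hint x'), intervalIntegral.integral_const,
    intervalIntegral.integral_const_mul, smul_eq_mul] at hmono
  have : 2 / l * ∫ s in t₀..t₁, |noise W s c - noise W t₀ c| ≤ τ / 4 := by
    calc _ ≤ 2 / l * (τ * l / 8) := by gcongr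
      _ = _ := by field_simp; ring
  linarith

/-- Flip the signs at the nodes `κ i` of the time blocks selected by `e`. -/
def flipMask (α : ℝ) (n : ℕ) (κ : Fin (numBlocks α n) → ℤ) (e : Fin (numBlocks α n) → Bool)
    (q : SignIndex) : Bool :=
  decide (∃ i : Fin (numBlocks α n), q = (n, numBlocks α n + (i : ℕ), κ i) ∧ e i = true)

lemma flipMask_of_ne_stage {κ : Fin (numBlocks α n) → ℤ} {e : Fin (numBlocks α n) → Bool}
    {q : SignIndex} (h : q.1 ≠ n) : flipMask α n κ e q = false := by
  rw [flipMask, decide_eq_false_iff_not]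
  rintro ⟨i, rfl, -⟩
  exact h rfl

lemma flipMask_node (κ : Fin (numBlocks α n) → ℤ) (e : Fin (numBlocks α n) → Bool)
    (i : Fin (numBlocks α n)) : flipMask α n κ e (n, numBlocks α n + (i : ℕ), κ i) = e i := by
  rw [flipMask, Bool.eq_iff_iff, decide_eq_true_iff]
  constructor
  · rintro ⟨j, hj, he⟩
    simp only [Prod.mk.injEq, true_and, add_right_inj] at hj
    rwa [Fin.ext hj.1]
  · exact fun h => ⟨i, rfl, h⟩

lemma flipMask_of_ne_node {κ : Fin (numBlocks α n) → ℤ} {e : Fin (numBlocks α n) → Bool}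
    {i : Fin (numBlocks α n)} {k : ℤ} (h : k ≠ κ i) :
    flipMask α n κ e (n, numBlocks α n + (i : ℕ), k) = false := by
  rw [flipMask, decide_eq_false_iff_not]
  rintro ⟨j, hj, -⟩
  simp only [Prod.mk.injEq, true_and, add_right_inj] at hj
  exact h (by rw [hj.2, Fin.ext hj.1])

/-- The difference of the two trajectories in the direction relevant at the end of stage `n`. -/
def separation (α : ℝ) (y : Space 2) (m n : ℕ) (ω : SignSpace) (W : Path0 2 1) : ℝ :=
  trajectory α m y ω W (stageTime n) (stageDir n) -
    trajectory α m (offsetStart y m) ω W (stageTime n) (stageDir n)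

/-- The nodes nearest to the first trajectory in the time blocks of stage `n`. -/
def nodes (α : ℝ) (y : Space 2) (m n : ℕ) (ω : SignSpace) (W : Path0 2 1)
    (i : Fin (numBlocks α n)) : ℤ :=
  nearestNode α W n i (trajectory α m y ω W (stageTime (n + 1)) (stageDir n + 1))

lemma separated_iff : Separated α y m n ω W ↔ gapScale n ≤ |separation α y m n ω W| := Iff.rfl

instance decidableSeparated : Decidable (Separated α y m n ω W) := Classical.dec _

lemma measurable_trajectory_at (α : ℝ) (m : ℕ) (z : Space 2) (t : ℝ) (c : Fin 2) :
    Measurable fun p : SignSpace × Path0 2 1 => trajectory α m z p.1 p.2 t c := by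
  have h1 : Measurable fun p : SignSpace × Path0 2 1 => (p.1, p.2, t) := by fun_prop
  have h2 := (measurable_trajectory α m z).comp h1
  exact (by fun_prop : Measurable fun x : Space 2 => x c).comp h2

lemma measurableSet_separated (α : ℝ) (y : Space 2) (m n : ℕ) :
    MeasurableSet {p : SignSpace × Path0 2 1 | Separated α y m n p.1 p.2} :=
  measurableSet_le measurable_const (measurable_norm.comp
    ((measurable_trajectory_at α m y (stageTime n) (stageDir n)).sub
      (measurable_trajectory_at α m (offsetStart y m) (stageTime n) (stageDir n))))

lemma measurableSet_separated_signs (α : ℝ) (y : Space 2) (m n : ℕ) (W : Path0 2 1) :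
    MeasurableSet {ω : SignSpace | Separated α y m n ω W} :=
  (measurable_id.prodMk measurable_const) (measurableSet_separated α y m n)

lemma measurable_nodes (α : ℝ) (y : Space 2) (m n : ℕ) (W : Path0 2 1) :
    Measurable fun ω => nodes α y m n ω W := by
  refine measurable_pi_lambda _ fun i => ?_
  have h : Measurable fun ω => trajectory α m y ω W (stageTime (n + 1)) (stageDir n + 1) :=
    (measurable_trajectory_at α m y _ _).comp (measurable_id.prodMk measurable_const)
  unfold nodes nearestNode
  simp_rw [round_eq]
  exact (((h.add_const _).div_const _).add_const _).floor

/-- An upper bound for the probability that the separation is lost during stage `n`. -/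
def lossBound (α : ℝ) (n : ℕ) : ℝ :=
  (gapScale n / (shearAmp α n * blockLen α n / 4) + 1) / √(numBlocks α n)

lemma trajectory_flip {κ : Fin (numBlocks α n) → ℤ} {e : Fin (numBlocks α n) → Bool}
    (z : Space 2) :
    trajectory α m z (fun q => xor (ω q) (flipMask α n κ e q)) W (stageTime (n + 1)) =
      trajectory α m z ω W (stageTime (n + 1)) := by
  refine trajectory_congr_signs (n := n + 1) (fun n' hn' j k => ?_) le_rfl
  rw [flipMask_of_ne_stage (by simpa using (by omega : n' ≠ n)), Bool.xor_false]

/-- The effect of flipping signs on the separation at the end of a stage. -/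
lemma separation_flip (hα : 0 ≤ α) (hn : n < m) (κ : Fin (numBlocks α n) → ℤ)
    (e : Fin (numBlocks α n) → Bool) {x x' : ℝ}
    (hx : x = trajectory α m y ω W (stageTime (n + 1)) (stageDir n + 1))
    (hx' : x' = trajectory α m (offsetStart y m) ω W (stageTime (n + 1)) (stageDir n + 1))
    {b : Fin (numBlocks α n) → ℝ}
    (hb : ∀ i, b i = -(shearAmp α n * signOf (ω (n, numBlocks α n + i, κ i)) *
      (nodeTime α W n i (κ i) x - nodeTime α W n i (κ i) x'))) :
    separation α y m n (fun q => xor (ω q) (flipMask α n κ e q)) W =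
      separation α y m n ω W + ∑ i, b i + ∑ i, signOf (e i) * b i := by
  set ω' : SignSpace := fun q => xor (ω q) (flipMask α n κ e q) with hω'
  have hflip : ∀ (i : Fin (numBlocks α n)) (x : ℝ), blockIntegral α ω' W n i x =
      blockIntegral α ω W n i x - signOf (ω (n, numBlocks α n + i, κ i)) * (signOf (e i) + 1) *
        nodeTime α W n i (κ i) x := by
    intro i x
    have h := blockIntegral_sub_of_eq_off (W := W) (ω := ω) (ω' := ω') (i := i) (κ := κ i)
      (fun k hk => by simp only [hω']; rw [flipMask_of_ne_node hk, Bool.xor_false]) x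
    have hs : signOf (ω' (n, numBlocks α n + (i : ℕ), κ i)) =
        -(signOf (ω (n, numBlocks α n + (i : ℕ), κ i)) * signOf (e i)) := by
      simp only [hω']; rw [flipMask_node, signOf_xor]
    rw [hs] at h
    linarith
  unfold separation
  rw [trajectory_dir hα hn, trajectory_dir hα hn, trajectory_dir hα hn, trajectory_dir hα hn,
    trajectory_flip, trajectory_flip, ← hx, ← hx', Finset.sum_range, Finset.sum_range,
    Finset.sum_range, Finset.sum_range]
  simp_rw [hflip]
  have hsum : ∑ i : Fin (numBlocks α n), shearAmp α n * (blockIntegral α ω W n i x -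
        signOf (ω (n, numBlocks α n + i, κ i)) * (signOf (e i) + 1) * nodeTime α W n i (κ i) x) -
      ∑ i : Fin (numBlocks α n), shearAmp α n * (blockIntegral α ω W n i x' -
        signOf (ω (n, numBlocks α n + i, κ i)) * (signOf (e i) + 1) * nodeTime α W n i (κ i) x') =
      ∑ i : Fin (numBlocks α n), shearAmp α n * blockIntegral α ω W n i x -
      ∑ i : Fin (numBlocks α n), shearAmp α n * blockIntegral α ω W n i x' +
      ∑ i, b i + ∑ i, signOf (e i) * b i := by
    rw [← Finset.sum_sub_distrib, ← Finset.sum_sub_distrib, ← Finset.sum_add_distrib,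
      ← Finset.sum_add_distrib]
    refine Finset.sum_congr rfl fun i _ => ?_
    rw [hb]; ring
  linarith

/-- Few of the flips at the nodes nearest to the first trajectory destroy the separation. -/
lemma card_flips_lost_le (hα : 0 ≤ α) (hn : n < m) (hreg : RegularAt α n W)
    (hsep : Separated α y m (n + 1) ω W) :
    ((Finset.univ.filter fun e : Fin (numBlocks α n) → Bool => ¬ Separated α y m n
      (fun q => xor (ω q) (flipMask α n (nodes α y m n ω W) e q)) W).card : ℝ) ≤
      lossBound α n * 2 ^ numBlocks α n := by
  set x := trajectory α m y ω W (stageTime (n + 1)) (stageDir n + 1) with hx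
  set x' := trajectory α m (offsetStart y m) ω W (stageTime (n + 1)) (stageDir n + 1) with hx'
  set κ := nodes α y m n ω W with hκ
  have hxx' : gapScale (n + 1) ≤ |x - x'| := by
    rw [Separated, stageDir_succ] at hsep; exact hsep
  set b : Fin (numBlocks α n) → ℝ := fun i =>
    -(shearAmp α n * signOf (ω (n, numBlocks α n + i, κ i)) *
      (nodeTime α W n i (κ i) x - nodeTime α W n i (κ i) x')) with hb
  have hA := shearAmp_pos α n
  have hτ := blockLen_pos α n
  have hbabs : ∀ i, shearAmp α n * blockLen α n / 4 ≤ |b i| := fun i => by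
    have h := le_nodeTime_sub i.2 hreg hxx'
    rw [hb]
    simp only []
    rw [abs_neg, abs_mul, abs_mul, abs_signOf, mul_one, abs_of_pos hA, mul_div_assoc]
    gcongr
    exact h.trans (le_abs_self _)
  have hcard := card_abs_signed_sum_lt_le_div_sqrt (k := 2 ^ blockExp α n) (by positivity) b
    (by positivity) hbabs (separation α y m n ω W + ∑ i, b i) (gapScale_pos n).le
  have heq : (Finset.univ.filter fun e : Fin (numBlocks α n) → Bool => ¬ Separated α y m n
      (fun q => xor (ω q) (flipMask α n κ e q)) W) = Finset.univ.filter
      fun e : Fin (numBlocks α n) → Bool =>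
        |separation α y m n ω W + ∑ i, b i + ∑ i, signOf (e i) * b i| < gapScale n := by
    refine Finset.filter_congr fun e _ => ?_
    rw [separated_iff, separation_flip hα hn κ e hx hx' (fun _ => rfl), not_le]
  rw [heq]
  exact hcard

/-- The separation is unlikely to be lost during a stage. -/
lemma measure_separation_lost_le (hα : 0 ≤ α) (hn : n < m) (hreg : RegularAt α n W) (y : Space 2) :
    coinMeasure SignIndex {ω | Separated α y m (n + 1) ω W ∧ ¬ Separated α y m n ω W} ≤
      ENNReal.ofReal (lossBound α n) := by
  have hloss : 0 ≤ lossBound α n := by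
    have hA := shearAmp_pos α n
    have hτ := blockLen_pos α n
    have hg := gapScale_pos n
    unfold lossBound; positivity
  set A : (Fin (numBlocks α n) → ℤ) → Set SignSpace := fun κ =>
    {ω | Separated α y m (n + 1) ω W} ∩ (fun ω => nodes α y m n ω W) ⁻¹' {κ} with hA
  set B : (Fin (numBlocks α n) → ℤ) → Set SignSpace := fun κ =>
    A κ ∩ {ω | Separated α y m n ω W}ᶜ with hB
  have hAm : ∀ κ, MeasurableSet (A κ) := fun κ =>
    (measurableSet_separated_signs α y m (n + 1) W).inter
      (measurable_nodes α y m n W (measurableSet_singleton κ))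
  have hBm : ∀ κ, MeasurableSet (B κ) := fun κ =>
    (hAm κ).inter (measurableSet_separated_signs α y m n W).compl
  have hAflip : ∀ κ e ω, (fun q => xor (ω q) (flipMask α n κ e q)) ∈ A κ ↔ ω ∈ A κ := by
    intro κ e ω
    simp only [hA, mem_inter_iff, mem_ofPred_eq, mem_preimage, mem_singleton_iff, Separated,
      funext_iff, nodes, trajectory_flip]
  have hstep : ∀ κ, coinMeasure SignIndex (B κ) ≤
      ENNReal.ofReal (lossBound α n) * coinMeasure SignIndex (A κ) := by
    intro κ
    refine coinMeasure_le_mul_of_flips (flipMask α n κ) (hAm κ) (hBm κ) _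
      (fun ω hω e hmem => hω ((hAflip κ e ω).1 hmem.1)) fun ω hω => ?_
    have hκ : nodes α y m n ω W = κ := hω.2
    have h := card_flips_lost_le hα hn hreg hω.1
    rw [hκ] at h
    have hsum : ∑ e, (B κ).indicator (1 : SignSpace → ℝ≥0∞)
        (fun q => xor (ω q) (flipMask α n κ e q)) =
        ((Finset.univ.filter fun e : Fin (numBlocks α n) → Bool => ¬ Separated α y m n
          (fun q => xor (ω q) (flipMask α n κ e q)) W).card : ℝ≥0∞) := by
      rw [Finset.card_filter, Nat.cast_sum]
      refine Finset.sum_congr rfl fun e _ => ?_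
      classical
      rw [indicator_apply]
      have : (fun q => xor (ω q) (flipMask α n κ e q)) ∈ B κ ↔ ¬ Separated α y m n
          (fun q => xor (ω q) (flipMask α n κ e q)) W :=
        ⟨fun h => h.2, fun h => ⟨(hAflip κ e ω).2 hω, h⟩⟩
      simp only [this, Pi.one_apply, Nat.cast_ite, Nat.cast_one, Nat.cast_zero]
    rw [hsum, Fintype.card_fun, Fintype.card_bool, Fintype.card_fin, ← ENNReal.ofReal_natCast,
      ← ENNReal.ofReal_natCast, ← ENNReal.ofReal_mul hloss]
    exact ENNReal.ofReal_le_ofReal (by exact_mod_cast h)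
  have hcover : {ω | Separated α y m (n + 1) ω W ∧ ¬ Separated α y m n ω W} ⊆ ⋃ κ, B κ :=
    fun ω hω => mem_iUnion.2 ⟨nodes α y m n ω W, ⟨hω.1, rfl⟩, hω.2⟩
  have hdisj : Pairwise (Function.onFun Disjoint A) := fun κ κ' hne =>
    disjoint_left.2 fun ω h h' => hne (h.2.symm.trans h'.2)
  calc _ ≤ coinMeasure SignIndex (⋃ κ, B κ) := measure_mono hcover
    _ ≤ ∑' κ, coinMeasure SignIndex (B κ) := measure_iUnion_le _
    _ ≤ ∑' κ, ENNReal.ofReal (lossBound α n) * coinMeasure SignIndex (A κ) :=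
        ENNReal.tsum_le_tsum hstep
    _ = ENNReal.ofReal (lossBound α n) * coinMeasure SignIndex (⋃ κ, A κ) := by
        rw [ENNReal.tsum_mul_left, measure_iUnion hdisj hAm]
    _ ≤ _ := mul_le_of_le_one_right' prob_le_one

end

noncomputable section

/-! ### Asymptotics of the parameters -/

lemma half_pow_eq_rpow (k : ℕ) : (1 / 2 : ℝ) ^ k = (2 : ℝ) ^ (-(k : ℝ)) := by
  rw [Real.rpow_neg (by norm_num), Real.rpow_natCast, one_div, inv_pow]

lemma shearScale_eq_rpow (n : ℕ) : shearScale n = (2 : ℝ) ^ (-((n + 1 : ℝ) ^ 2 + 1)) := by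
  rw [shearScale, half_pow_eq_rpow]; push_cast; rfl

lemma gapScale_eq_rpow (n : ℕ) : gapScale n = (2 : ℝ) ^ (-(n : ℝ) ^ 2) := by
  rw [gapScale, half_pow_eq_rpow]; push_cast; rfl

lemma blockLen_eq_rpow (α : ℝ) (n : ℕ) :
    blockLen α n = (2 : ℝ) ^ (-(blockExp α n + n + 2 : ℝ)) := by
  rw [blockLen, half_pow_eq_rpow]; push_cast; rfl

lemma numBlocks_eq_rpow (α : ℝ) (n : ℕ) : (numBlocks α n : ℝ) = (2 : ℝ) ^ (blockExp α n + 1 : ℝ) := by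
  rw [numBlocks, ← pow_succ', ← Nat.cast_succ, Real.rpow_natCast]; push_cast; rfl

lemma le_blockExp (α : ℝ) (n : ℕ) : 2 * (1 - α) * n ^ 2 - 10 * n - 1 ≤ blockExp α n := by
  have h1 := Nat.lt_floor_add_one (2 * (1 - α) * (n : ℝ) ^ 2)
  have h2 : ((⌊2 * (1 - α) * (n : ℝ) ^ 2⌋₊ : ℕ) : ℝ) ≤ blockExp α n + 10 * n := by
    have : ⌊2 * (1 - α) * (n : ℝ) ^ 2⌋₊ ≤ blockExp α n + 10 * n := by unfold blockExp; omega
    exact_mod_cast this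
  linarith

lemma blockExp_le {α : ℝ} (hα : α < 1 / 2) {n : ℕ} (hn : 10 ≤ n) :
    (blockExp α n : ℝ) ≤ 2 * (1 - α) * n ^ 2 - 10 * n := by
  have hn' : (10 : ℝ) ≤ n := by exact_mod_cast hn
  have h0 : (10 * n : ℝ) ≤ 2 * (1 - α) * n ^ 2 := by
    have : (10 * n : ℝ) ≤ 1 * n ^ 2 := by nlinarith
    refine this.trans ?_
    gcongr; linarith
  have h1 : 10 * n ≤ ⌊2 * (1 - α) * (n : ℝ) ^ 2⌋₊ := Nat.le_floor (by exact_mod_cast h0)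
  have h2 := Nat.floor_le ((by positivity : (0 : ℝ) ≤ 10 * n).trans h0)
  unfold blockExp
  rw [Nat.cast_sub h1]
  push_cast
  linarith

lemma lossBound_le {α : ℝ} (hα0 : 0 ≤ α) (hα : α < 1 / 2) {n : ℕ} (hn : 13 ≤ n) :
    lossBound α n ≤ 2 * (1 / 2) ^ n := by
  have hn' : (13 : ℝ) ≤ n := by exact_mod_cast hn
  have hK := blockExp_le hα (by omega : 10 ≤ n)
  have hK' := le_blockExp α n
  have h2 : (0 : ℝ) < 2 := by norm_num
  have hsqrt : √(numBlocks α n : ℝ) = (2 : ℝ) ^ ((blockExp α n + 1 : ℝ) / 2) := by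
    rw [numBlocks_eq_rpow, Real.sqrt_eq_rpow, ← Real.rpow_mul h2.le]; congr 1; ring
  have hAτ : shearAmp α n * blockLen α n / 4 =
      (2 : ℝ) ^ (-((n + 1 : ℝ) ^ 2 + 1) * α - (blockExp α n + n + 2) - 3) := by
    rw [shearAmp, shearScale_eq_rpow, blockLen_eq_rpow, ← Real.rpow_mul h2.le, Real.rpow_sub h2,
      sub_eq_add_neg, Real.rpow_add h2]
    norm_num
    ring
  have hhalf : (1 / 2 : ℝ) ^ n = (2 : ℝ) ^ (-(n : ℝ)) := half_pow_eq_rpow n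
  have e1 : gapScale n / (shearAmp α n * blockLen α n / 4) / √(numBlocks α n : ℝ) ≤
      (2 : ℝ) ^ (-(n : ℝ)) := by
    rw [hAτ, hsqrt, gapScale_eq_rpow, ← Real.rpow_sub h2, ← Real.rpow_sub h2]
    refine Real.rpow_le_rpow_of_exponent_le (by norm_num) ?_
    nlinarith [mul_nonneg hα0 (by linarith : (0 : ℝ) ≤ n)]
  have e2 : 1 / √(numBlocks α n : ℝ) ≤ (2 : ℝ) ^ (-(n : ℝ)) := by
    rw [hsqrt, one_div, ← Real.rpow_neg h2.le]
    refine Real.rpow_le_rpow_of_exponent_le (by norm_num) ?_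
    nlinarith [mul_nonneg (by linarith : (0 : ℝ) ≤ 1 - 2 * α) (sq_nonneg (n : ℝ))]
  rw [lossBound, add_div, hhalf]
  linarith

open Filter in
lemma eventually_mul_le_mul_sq (c : ℝ) {η : ℝ} (hη : 0 < η) :
    ∀ᶠ n : ℕ in atTop, c * n ≤ η * (n : ℝ) ^ 2 := by
  filter_upwards [tendsto_natCast_atTop_atTop.eventually (eventually_ge_atTop (c / η))] with n hn
  rw [div_le_iff₀ hη] at hn
  nlinarith [(Nat.cast_nonneg n : (0 : ℝ) ≤ n)]

/-! ### Separation at infinitely many scales -/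

section Chain

open Filter Topology

variable {α : ℝ} {y : Space 2} {W : Path0 2 1}

lemma separated_self (ω : SignSpace) (m : ℕ) : Separated α y m m ω W := by
  rw [Separated, trajectory_of_le le_rfl, trajectory_of_le le_rfl, offsetStart]
  simp [abs_of_pos (gapScale_pos m)]

lemma measure_not_separated_le (hα0 : 0 ≤ α) (hα : α < 1 / 2) {n₀ : ℕ} (hn₀ : 13 ≤ n₀)
    (hreg : ∀ n ≥ n₀, RegularAt α n W) (d : ℕ) : ∀ {n : ℕ}, n₀ ≤ n →
    coinMeasure SignIndex {ω | ¬ Separated α y (n + d) n ω W} ≤ ENNReal.ofReal (4 * (1 / 2) ^ n) := by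
  induction d with
  | zero =>
    intro n _
    simp [separated_self]
  | succ d ih =>
    intro n hn
    have h1 := ih (n := n + 1) (by omega)
    rw [show n + 1 + d = n + (d + 1) by ring] at h1
    have h2 := (measure_separation_lost_le hα0 (by omega : n < n + (d + 1)) (hreg n hn) y).trans
      (ENNReal.ofReal_le_ofReal (lossBound_le hα0 hα (hn₀.trans hn)))
    have hsub : {ω | ¬ Separated α y (n + (d + 1)) n ω W} ⊆
        {ω | ¬ Separated α y (n + (d + 1)) (n + 1) ω W} ∪
        {ω | Separated α y (n + (d + 1)) (n + 1) ω W ∧ ¬ Separated α y (n + (d + 1)) n ω W} := by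
      intro ω hω
      by_cases h : Separated α y (n + (d + 1)) (n + 1) ω W
      · exact Or.inr ⟨h, hω⟩
      · exact Or.inl h
    calc _ ≤ _ := (measure_mono hsub).trans (measure_union_le _ _)
      _ ≤ ENNReal.ofReal (4 * (1 / 2) ^ (n + 1)) + ENNReal.ofReal (2 * (1 / 2) ^ n) :=
          add_le_add h1 h2
      _ = ENNReal.ofReal (4 * (1 / 2) ^ n) := by
          rw [← ENNReal.ofReal_add (by positivity) (by positivity), pow_succ]; congr 1; ring

lemma measure_not_frequently_separated_le (hα0 : 0 ≤ α) (hα : α < 1 / 2) {n₀ : ℕ} (hn₀ : 13 ≤ n₀)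
    (hreg : ∀ n ≥ n₀, RegularAt α n W) {n : ℕ} (hn : n₀ ≤ n) :
    coinMeasure SignIndex {ω | ¬ ∃ᶠ m in atTop, Separated α y m n ω W} ≤
      ENNReal.ofReal (4 * (1 / 2) ^ n) := by
  have heq : {ω | ¬ ∃ᶠ m in atTop, Separated α y m n ω W} =
      ⋃ M : ℕ, {ω | ∀ m ≥ M, ¬ Separated α y m n ω W} := by
    ext ω
    simp only [mem_ofPred_eq, not_frequently, eventually_atTop, mem_iUnion]
  have hmono : Monotone fun M : ℕ => {ω | ∀ m ≥ M, ¬ Separated α y m n ω W} :=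
    fun M M' hMM' ω hω m hm => hω m (hMM'.trans hm)
  rw [heq, hmono.measure_iUnion]
  refine iSup_le fun M => ?_
  refine (measure_mono ?_).trans (measure_not_separated_le (y := y) hα0 hα hn₀ hreg M hn)
  exact fun ω hω => hω (n + M) (by omega)

lemma ae_frequently_separated (hα0 : 0 ≤ α) (hα : α < 1 / 2)
    (hreg : ∀ᶠ n in atTop, RegularAt α n W) (y : Space 2) :
    ∀ᵐ ω ∂coinMeasure SignIndex, ∃ᶠ n in atTop, ∃ᶠ m in atTop, Separated α y m n ω W := by
  obtain ⟨n₁, hn₁⟩ := eventually_atTop.1 hreg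
  have hreg' : ∀ n ≥ max n₁ 13, RegularAt α n W := fun n hn => hn₁ n (le_trans (le_max_left _ _) hn)
  have hlim : Tendsto (fun n : ℕ => ENNReal.ofReal (4 * (1 / 2) ^ n)) atTop (𝓝 0) := by
    have h := (tendsto_pow_atTop_nhds_zero_of_lt_one (r := (1 / 2 : ℝ)) (by norm_num)
      (by norm_num)).const_mul 4
    simpa using ENNReal.tendsto_ofReal h
  have hall : ∀ M : ℕ, ∀ᵐ ω ∂coinMeasure SignIndex, ∃ n ≥ M, ∃ᶠ m in atTop,
      Separated α y m n ω W := by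
    intro M
    rw [ae_iff]
    refine le_antisymm (ge_of_tendsto hlim ?_) zero_le
    filter_upwards [eventually_ge_atTop (max n₁ 13), eventually_ge_atTop M] with n hn hnM
    refine (measure_mono fun ω hω => ?_).trans
      (measure_not_frequently_separated_le (y := y) hα0 hα (le_max_right _ _) hreg' hn)
    exact fun h => hω ⟨n, hnM, h⟩
  filter_upwards [ae_all_iff.2 hall] with ω hω
  exact frequently_atTop.2 hω

end Chain

/-! ### Regularity of Hölder paths -/

lemma noise_sub_noise {W : Path0 2 1} {s t : ℝ} (hs : s ∈ Icc (0 : ℝ) (1 : ℝ≥0))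
    (ht : t ∈ Icc (0 : ℝ) (1 : ℝ≥0)) : noise W s - noise W t = W ⟨s, hs⟩ - W ⟨t, ht⟩ := by
  unfold noise
  rw [IccExtend_path hs, IccExtend_path ht, sub_sub_sub_cancel_right]

lemma mem_unit_of_mem_block {α : ℝ} {n i : ℕ} (hi : i < numBlocks α n) {s : ℝ}
    (hs : s ∈ Icc (blockStart α n i) (blockStart α n (i + 1))) : s ∈ Icc (0 : ℝ) (1 : ℝ≥0) := by
  have h := block_subset hi hs
  exact ⟨(stageTime_pos _).le.trans h.1, h.2.trans (stageTime_le_one n)⟩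

open Filter in
lemma eventually_mul_blockLen_rpow_le {α β : ℝ} (hβ0 : 0 ≤ β) (hβ1 : β ≤ 1)
    (hβ : 1 < 2 * (1 - α) * β) (C : ℝ) :
    ∀ᶠ n in atTop, C * blockLen α n ^ β ≤ shearScale n / 8 := by
  have h2 : (0 : ℝ) < 2 := by norm_num
  obtain ⟨κ, hκ⟩ : ∃ κ : ℕ, C ≤ (2 : ℝ) ^ (κ : ℝ) := by
    obtain ⟨κ, hκ⟩ := pow_unbounded_of_one_lt C (by norm_num : (1 : ℝ) < 2)
    exact ⟨κ, by rw [Real.rpow_natCast]; exact hκ.le⟩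
  filter_upwards [eventually_mul_le_mul_sq (κ + 16 : ℝ) (sub_pos.2 hβ), eventually_ge_atTop 1]
    with n hn hn1
  have hn1' : (1 : ℝ) ≤ n := by exact_mod_cast hn1
  have hK := le_blockExp α n
  have hpos : 0 ≤ blockLen α n ^ β := Real.rpow_nonneg (blockLen_pos α n).le _
  refine (mul_le_mul_of_nonneg_right hκ hpos).trans ?_
  have e8 : shearScale n / 8 = (2 : ℝ) ^ (-((n + 1 : ℝ) ^ 2 + 1) - 3) := by
    rw [Real.rpow_sub h2, ← shearScale_eq_rpow]; norm_num
  rw [e8, blockLen_eq_rpow, ← Real.rpow_mul h2.le, ← Real.rpow_add h2]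
  refine Real.rpow_le_rpow_of_exponent_le (by norm_num) ?_
  have h3 : β * (2 * (1 - α) * n ^ 2 - 9 * n) ≤ β * (blockExp α n + n + 2) := by gcongr; linarith
  have h4 : β * (9 * n) ≤ 9 * n := by nlinarith
  have h5 : (κ : ℝ) ≤ κ * n := by nlinarith [(Nat.cast_nonneg κ : (0 : ℝ) ≤ κ)]
  nlinarith

open Filter in
lemma eventually_regularAt_of_memHolder {α : ℝ} {β : ℝ≥0} (hβ1 : β ≤ 1)
    (hβ : 1 < 2 * (1 - α) * β) {W : Path0 2 1} (hW : MemHolder β W) :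
    ∀ᶠ n in atTop, RegularAt α n W := by
  obtain ⟨C, hC⟩ := hW
  filter_upwards [eventually_mul_blockLen_rpow_le β.coe_nonneg (by exact_mod_cast hβ1) hβ C]
    with n hn i hi
  have hτ := blockLen_pos α n
  have hle : blockStart α n i ≤ blockStart α n (i + 1) := blockStart_mono α n (Nat.le_succ i)
  have hpt : ∀ s ∈ Icc (blockStart α n i) (blockStart α n (i + 1)),
      |noise W s (stageDir n + 1) - noise W (blockStart α n i) (stageDir n + 1)| ≤
        shearScale n / 8 := by
    intro s hs
    have hs1 := mem_unit_of_mem_block hi hs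
    have hs0 := mem_unit_of_mem_block hi (left_mem_Icc.2 hle)
    refine le_trans ?_ hn
    rw [← PiLp.sub_apply, noise_sub_noise hs1 hs0]
    refine (PiLp.norm_apply_le (W ⟨s, hs1⟩ - W ⟨_, hs0⟩) (stageDir n + 1)).trans ?_
    rw [← dist_eq_norm]
    have h := hC.dist_le ⟨s, hs1⟩ ⟨_, hs0⟩
    refine h.trans ?_
    gcongr
    rw [Subtype.dist_eq, Real.dist_eq, abs_of_nonneg (sub_nonneg.2 hs.1)]
    rw [blockStart_succ] at hs
    linarith [hs.2]
  have hw := continuous_noise_apply W (stageDir n + 1)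
  calc _ ≤ ∫ s in blockStart α n i..blockStart α n (i + 1), shearScale n / 8 :=
        intervalIntegral.integral_mono_on hle
          ((hw.sub continuous_const).abs.intervalIntegrable _ _) intervalIntegrable_const hpt
    _ = _ := by
        rw [intervalIntegral.integral_const, blockStart_succ, smul_eq_mul]; ring

end

noncomputable section

/-! ### Regularity of fractional Brownian paths -/

/-- The absolute moments of the standard Gaussian. -/
def gaussianMoment (Q : ℕ) : ℝ≥0∞ := ∫⁻ x, ‖x‖ₑ ^ Q ∂gaussianReal 0 1

lemma gaussianMoment_lt_top (Q : ℕ) : gaussianMoment Q < ∞ := by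
  have h := (memLp_id_gaussianReal (μ := 0) (v := 1) Q).integrable_norm_pow'.2
  simpa [HasFiniteIntegral, gaussianMoment] using h

lemma lintegral_enorm_pow_gaussianReal (v : ℝ≥0) (Q : ℕ) :
    ∫⁻ x, ‖x‖ₑ ^ Q ∂gaussianReal 0 v = ENNReal.ofReal √v ^ Q * gaussianMoment Q := by
  have h : gaussianReal 0 v = (gaussianReal 0 1).map (√(v : ℝ) * ·) := by
    rw [gaussianReal_map_const_mul, mul_zero, mul_one]
    congr 1
    ext
    exact (Real.sq_sqrt v.coe_nonneg).symm
  have hm : Measurable fun x : ℝ => ‖x‖ₑ ^ Q := by fun_prop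
  rw [h, lintegral_map hm (by fun_prop), gaussianMoment, ← lintegral_const_mul _ hm]
  refine lintegral_congr fun x => ?_
  rw [enorm_mul, mul_pow, Real.enorm_of_nonneg (Real.sqrt_nonneg _)]

section FractionalBrownian

variable {H : ℝ} {ν : Measure (Path0 2 1)}

lemma hasGaussianLaw_apply (hν : IsFractionalBrownianLaw H ν) (t : Icc (0 : ℝ) (1 : ℝ≥0))
    (c : Fin 2) : HasGaussianLaw (fun W : Path0 2 1 => W t c) ν :=
  (hν.isGaussianProcess.hasGaussianLaw_eval t).map_fun (EuclideanSpace.proj c)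

lemma hasGaussianLaw_increment (hν : IsFractionalBrownianLaw H ν) (t s : Icc (0 : ℝ) (1 : ℝ≥0))
    (c : Fin 2) : HasGaussianLaw (fun W : Path0 2 1 => (W t - W s) c) ν :=
  (hν.isGaussianProcess.hasGaussianLaw_fun_sub (s := t) (t := s)).map_fun (EuclideanSpace.proj c)

lemma map_increment_eq_gaussianReal (hH : 0 < H) (hν : IsFractionalBrownianLaw H ν)
    (t s : Icc (0 : ℝ) (1 : ℝ≥0)) (c : Fin 2) :
    ν.map (fun W : Path0 2 1 => (W t - W s) c) =
      gaussianReal 0 (|(t : ℝ) - s| ^ (2 * H)).toNNReal := by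
  have := hν.isProbabilityMeasure
  have hgt := hasGaussianLaw_apply hν t c
  have hgs := hasGaussianLaw_apply hν s c
  have hmean : ∫ W : Path0 2 1, (W t - W s) c ∂ν = 0 := by
    simp_rw [PiLp.sub_apply]
    rw [integral_sub hgt.integrable hgs.integrable, hν.centered, hν.centered, sub_zero]
  have hH0 : (0 : ℝ) ^ (2 * H) = 0 := Real.zero_rpow (by positivity)
  have hvar : Var[fun W : Path0 2 1 => (W t - W s) c; ν] = |(t : ℝ) - s| ^ (2 * H) := by
    rw [variance_eq_integral (hasGaussianLaw_increment hν t s c).aemeasurable, hmean]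
    have hexp : ∀ W : Path0 2 1, ((W t - W s) c - 0) ^ 2 =
        W t c * W t c - 2 * (W t c * W s c) + W s c * W s c := fun W => by
      rw [PiLp.sub_apply]; ring
    have htt : Integrable (fun W : Path0 2 1 => W t c * W t c) ν :=
      hgt.memLp_two.integrable_mul hgt.memLp_two
    have hts : Integrable (fun W : Path0 2 1 => W t c * W s c) ν :=
      hgt.memLp_two.integrable_mul hgs.memLp_two
    have hss : Integrable (fun W : Path0 2 1 => W s c * W s c) ν :=
      hgs.memLp_two.integrable_mul hgs.memLp_two
    have hsub : Integrable (fun W : Path0 2 1 => W t c * W t c - 2 * (W t c * W s c)) ν :=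
      htt.sub (hts.const_mul 2)
    simp_rw [hexp]
    rw [integral_add hsub hss, integral_sub htt (hts.const_mul 2),
      integral_const_mul, hν.covariance, hν.covariance, hν.covariance]
    simp only [if_true, sub_self, abs_zero, hH0]
    ring
  rw [(hasGaussianLaw_increment hν t s c).map_eq_gaussianReal, hmean, hvar]

lemma lintegral_enorm_increment_pow (hH : 0 < H) (hν : IsFractionalBrownianLaw H ν)
    (t s : Icc (0 : ℝ) (1 : ℝ≥0)) (c : Fin 2) (Q : ℕ) :
    ∫⁻ W : Path0 2 1, ‖(W t - W s) c‖ₑ ^ Q ∂ν =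
      ENNReal.ofReal (|(t : ℝ) - s| ^ H) ^ Q * gaussianMoment Q := by
  have hm : Measurable fun x : ℝ => ‖x‖ₑ ^ Q := by fun_prop
  rw [← lintegral_map' hm.aemeasurable (hasGaussianLaw_increment hν t s c).aemeasurable,
    map_increment_eq_gaussianReal hH hν, lintegral_enorm_pow_gaussianReal,
    Real.coe_toNNReal _ (by positivity), Real.sqrt_eq_rpow, ← Real.rpow_mul (abs_nonneg _)]
  congr 4; ring

lemma abs_le_add_pow_div {r : ℝ} (hr : 0 < r) (q : ℕ) (x : ℝ) :
    |x| ≤ r + |x| ^ (q + 1) / r ^ q := by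
  rcases le_total |x| r with h | h
  · have : 0 ≤ |x| ^ (q + 1) / r ^ q := by positivity
    linarith
  · have h1 : |x| * 1 ≤ |x| * (|x| / r) ^ q := by
      gcongr; exact one_le_pow₀ ((one_le_div hr).2 h)
    have h2 : |x| ^ (q + 1) / r ^ q = |x| * (|x| / r) ^ q := by rw [div_pow, pow_succ]; ring
    linarith

/-- A path whose oscillation has a small moment over an interval has small mean oscillation. -/
lemma integral_abs_le_of_lintegral_pow_lt {f : ℝ → ℝ} (hf : Continuous f) {a b r : ℝ} (hab : a ≤ b)
    (hr : 0 < r) (q : ℕ)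
    (h : ∫⁻ s in Ioc a b, ‖f s‖ₑ ^ (q + 1) < ENNReal.ofReal ((b - a) * r ^ (q + 1))) :
    ∫ s in a..b, |f s| ≤ 2 * ((b - a) * r) := by
  have hpow : Continuous fun s => |f s| ^ (q + 1) := by fun_prop
  have hI : ∫ s in a..b, |f s| ^ (q + 1) ≤ (b - a) * r ^ (q + 1) := by
    rw [intervalIntegral.integral_of_le hab]
    have hint : Integrable (fun s => |f s| ^ (q + 1)) (volume.restrict (Ioc a b)) :=
      (hpow.integrableOn_Icc (μ := volume) (a := a) (b := b)).mono_set Ioc_subset_Icc_self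
    have heq : ENNReal.ofReal (∫ s in Ioc a b, |f s| ^ (q + 1)) =
        ∫⁻ s in Ioc a b, ‖f s‖ₑ ^ (q + 1) := by
      rw [ofReal_integral_eq_lintegral_ofReal hint (Filter.Eventually.of_forall fun s => by positivity)]
      refine lintegral_congr fun s => ?_
      rw [ENNReal.ofReal_pow (abs_nonneg _), Real.enorm_eq_ofReal_abs]
    rw [← heq] at h
    exact (ENNReal.ofReal_lt_ofReal_iff'.1 h).1.le
  have hmono := intervalIntegral.integral_mono_on (μ := volume) (f := fun s => |f s|)
    (g := fun s => r + |f s| ^ (q + 1) / r ^ q) hab (hf.abs.intervalIntegrable _ _)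
    (Continuous.intervalIntegrable (continuous_const.add (hpow.div_const _)) _ _)
    fun s _ => abs_le_add_pow_div hr q (f s)
  rw [intervalIntegral.integral_add intervalIntegrable_const
    ((hpow.div_const _).intervalIntegrable _ _), intervalIntegral.integral_const,
    intervalIntegral.integral_div, smul_eq_mul] at hmono
  have : (∫ s in a..b, |f s| ^ (q + 1)) / r ^ q ≤ (b - a) * r := by
    rw [div_le_iff₀ (by positivity)]
    calc _ ≤ _ := hI
      _ = _ := by ring
  linarith

lemma measure_block_oscillation_le {α : ℝ} (hH : 0 < H) (hν : IsFractionalBrownianLaw H ν) {n i : ℕ}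
    (hi : i < numBlocks α n) (q : ℕ) :
    ν {W | ¬ ∫ s in blockStart α n i..blockStart α n (i + 1),
      |noise W s (stageDir n + 1) - noise W (blockStart α n i) (stageDir n + 1)| ≤
        blockLen α n * shearScale n / 8} ≤
      ENNReal.ofReal ((blockLen α n ^ H / (shearScale n / 16)) ^ (q + 1)) *
        gaussianMoment (q + 1) := by
  have := hν.isProbabilityMeasure
  have hτ := blockLen_pos α n
  have hl := shearScale_pos n
  have hle : blockStart α n i ≤ blockStart α n (i + 1) := blockStart_mono α n (Nat.le_succ i)
  have hlen : blockStart α n (i + 1) - blockStart α n i = blockLen α n := by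
    rw [blockStart_succ]; ring
  set a := blockStart α n i
  set b := blockStart α n (i + 1)
  set c := stageDir n + 1
  set r := shearScale n / 16 with hr
  have hr0 : 0 < r := by positivity
  have hmeas : Measurable fun p : Path0 2 1 × ℝ => ‖noise p.1 p.2 c - noise p.1 a c‖ₑ ^ (q + 1) := by
    have h1 : Measurable fun p : Path0 2 1 × ℝ => noise p.1 p.2 c :=
      (by fun_prop : Measurable fun x : Space 2 => x c).comp measurable_noise
    have h2 : Measurable fun p : Path0 2 1 × ℝ => noise p.1 a c :=
      h1.comp (measurable_fst.prodMk measurable_const)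
    exact (h1.sub h2).enorm.pow_const _
  have hsub : {W : Path0 2 1 | ¬ ∫ s in a..b, |noise W s c - noise W a c| ≤
      blockLen α n * shearScale n / 8} ⊆ {W | ENNReal.ofReal (blockLen α n * r ^ (q + 1)) ≤
        ∫⁻ s in Ioc a b, ‖noise W s c - noise W a c‖ₑ ^ (q + 1)} := by
    intro W hW
    by_contra hcon
    refine hW ?_
    have h := integral_abs_le_of_lintegral_pow_lt
      ((continuous_noise_apply W c).sub continuous_const) hle hr0 q
      (by rw [hlen]; exact not_le.1 hcon)
    rw [hlen] at h
    refine h.trans (le_of_eq ?_)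
    rw [hr]; ring
  have hswap : ∫⁻ W, (∫⁻ s in Ioc a b, ‖noise W s c - noise W a c‖ₑ ^ (q + 1)) ∂ν ≤
      ENNReal.ofReal (blockLen α n) *
        (ENNReal.ofReal ((blockLen α n ^ H) ^ (q + 1)) * gaussianMoment (q + 1)) := by
    rw [lintegral_lintegral_swap hmeas.aemeasurable]
    have hpt : ∀ s ∈ Ioc a b, ∫⁻ W : Path0 2 1, ‖noise W s c - noise W a c‖ₑ ^ (q + 1) ∂ν ≤
        ENNReal.ofReal ((blockLen α n ^ H) ^ (q + 1)) * gaussianMoment (q + 1) := by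
      intro s hs
      have hs1 := mem_unit_of_mem_block hi (Ioc_subset_Icc_self hs)
      have ha1 := mem_unit_of_mem_block hi (left_mem_Icc.2 hle)
      have heq : ∀ W : Path0 2 1, noise W s c - noise W a c = (W ⟨s, hs1⟩ - W ⟨a, ha1⟩) c :=
        fun W => by rw [← PiLp.sub_apply, noise_sub_noise hs1 ha1]
      simp_rw [heq]
      rw [lintegral_enorm_increment_pow hH hν, ← ENNReal.ofReal_pow (by positivity)]
      gcongr
      rw [abs_of_nonneg (sub_nonneg.2 hs.1.le)]
      linarith [hs.2]
    calc _ ≤ ∫⁻ s in Ioc a b, (ENNReal.ofReal ((blockLen α n ^ H) ^ (q + 1)) *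
          gaussianMoment (q + 1)) := setLIntegral_mono' measurableSet_Ioc hpt
      _ = _ := by rw [setLIntegral_const, Real.volume_Ioc, hlen, mul_comm]
  refine (measure_mono hsub).trans ((meas_ge_le_lintegral_div
    (hmeas.lintegral_prod_right' (ν := volume.restrict (Ioc a b))).aemeasurable ?_ (by simp)).trans ?_)
  · exact (ENNReal.ofReal_pos.2 (by positivity)).ne'
  · refine (ENNReal.div_le_div_right hswap _).trans (le_of_eq ?_)
    rw [← mul_assoc, ← ENNReal.ofReal_mul hτ.le, ENNReal.mul_div_right_comm,
      ← ENNReal.ofReal_div_of_pos (by positivity)]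
    congr 2
    rw [mul_div_mul_left _ _ hτ.ne', ← div_pow]

open Filter in
lemma exists_moment_summable {α H : ℝ} (hα0 : 0 ≤ α) (hα : α < 1 / 2) (hH1 : H < 1) (hH0 : 0 < H)
    (hH : 1 < 2 * (1 - α) * H) :
    ∃ q : ℕ, ∀ᶠ n in atTop, (numBlocks α n : ℝ) *
      (blockLen α n ^ H / (shearScale n / 16)) ^ (q + 1) ≤ (1 / 2) ^ n := by
  have h2 : (0 : ℝ) < 2 := by norm_num
  set η := 2 * (1 - α) * H - 1 with hη
  have hη0 : 0 < η := sub_pos.2 hH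
  obtain ⟨q, hq⟩ := exists_nat_ge (3 / η)
  refine ⟨q, ?_⟩
  set Q : ℝ := (q : ℝ) + 1 with hQ
  have hQη : 3 ≤ Q * η := by
    rw [div_le_iff₀ hη0] at hq
    nlinarith
  have hQ1 : 1 ≤ Q := by rw [hQ]; linarith [(Nat.cast_nonneg q : (0 : ℝ) ≤ q)]
  filter_upwards [eventually_mul_le_mul_sq (20 * Q + 2) one_pos, eventually_ge_atTop 10] with n hn hn10
  have hn' : (10 : ℝ) ≤ n := by exact_mod_cast hn10
  have hK := le_blockExp α n
  have hK' := blockExp_le hα hn10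
  have e16 : shearScale n / 16 = (2 : ℝ) ^ (-((n + 1 : ℝ) ^ 2 + 1) - 4) := by
    rw [Real.rpow_sub h2, ← shearScale_eq_rpow]; norm_num
  rw [e16, blockLen_eq_rpow, ← Real.rpow_mul h2.le, ← Real.rpow_sub h2, numBlocks_eq_rpow,
    ← Real.rpow_natCast, ← Real.rpow_mul h2.le, ← Real.rpow_add h2, half_pow_eq_rpow]
  refine Real.rpow_le_rpow_of_exponent_le (by norm_num) ?_
  push_cast
  rw [← hQ]
  have h3 : (1 + η) * (n : ℝ) ^ 2 - 9 * n ≤ H * (blockExp α n + n + 2) := by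
    have : H * (2 * (1 - α) * n ^ 2 - 9 * n) ≤ H * (blockExp α n + n + 2) := by gcongr; linarith
    have h9 : H * (9 * n) ≤ 9 * n := by nlinarith
    have : H * (2 * (1 - α) * n ^ 2) = (1 + η) * (n : ℝ) ^ 2 := by rw [hη]; ring
    linarith
  have h4 : -(blockExp α n + n + 2 : ℝ) * H - (-((n + 1 : ℝ) ^ 2 + 1) - 4) ≤
      -(η * (n : ℝ) ^ 2) + 12 * n := by nlinarith
  have h5 := mul_le_mul_of_nonneg_right h4 (by linarith : 0 ≤ Q)
  have h6 : 3 * (n : ℝ) ^ 2 ≤ Q * η * (n : ℝ) ^ 2 := by gcongr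
  have h7 : (blockExp α n : ℝ) ≤ 2 * n ^ 2 - 10 * n := by
    have : 0 ≤ α * (n : ℝ) ^ 2 := by positivity
    linarith
  nlinarith [mul_nonneg (by linarith : 0 ≤ Q) (by linarith : (0 : ℝ) ≤ n)]

open Filter in
lemma ae_eventually_regularAt {α : ℝ} (hα0 : 0 ≤ α) (hα : α < 1 / 2) (hH0 : 0 < H) (hH1 : H < 1)
    (hH : 1 < 2 * (1 - α) * H) (hν : IsFractionalBrownianLaw H ν) :
    ∀ᵐ W ∂ν, ∀ᶠ n in atTop, RegularAt α n W := by
  obtain ⟨q, hq⟩ := exists_moment_summable hα0 hα hH1 hH0 hH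
  obtain ⟨n₀, hn₀⟩ := eventually_atTop.1 hq
  have hbound : ∀ n ≥ n₀, ν {W | ¬ RegularAt α n W} ≤
      ENNReal.ofReal ((1 / 2) ^ n) * gaussianMoment (q + 1) := by
    intro n hn
    have hτ := blockLen_pos α n
    have hl := shearScale_pos n
    have hsub : {W | ¬ RegularAt α n W} ⊆ ⋃ i ∈ Finset.range (numBlocks α n),
        {W | ¬ ∫ s in blockStart α n i..blockStart α n (i + 1),
          |noise W s (stageDir n + 1) - noise W (blockStart α n i) (stageDir n + 1)| ≤
            blockLen α n * shearScale n / 8} := by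
      intro W hW
      simp only [RegularAt, mem_ofPred_eq, not_forall] at hW
      obtain ⟨i, hi, h⟩ := hW
      exact mem_iUnion₂.2 ⟨i, Finset.mem_range.2 hi, h⟩
    calc _ ≤ _ := (measure_mono hsub).trans (measure_biUnion_finset_le _ _)
      _ ≤ ∑ i ∈ Finset.range (numBlocks α n), ENNReal.ofReal
          ((blockLen α n ^ H / (shearScale n / 16)) ^ (q + 1)) * gaussianMoment (q + 1) :=
          Finset.sum_le_sum fun i hi =>
            measure_block_oscillation_le hH0 hν (Finset.mem_range.1 hi) q
      _ = ENNReal.ofReal ((numBlocks α n : ℝ) *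
          (blockLen α n ^ H / (shearScale n / 16)) ^ (q + 1)) * gaussianMoment (q + 1) := by
          rw [Finset.sum_const, Finset.card_range, nsmul_eq_mul,
            ENNReal.ofReal_mul (Nat.cast_nonneg _), ENNReal.ofReal_natCast, mul_assoc]
      _ ≤ _ := by gcongr; exact hn₀ n hn
  have hsum : ∑' n, ν {W | ¬ RegularAt α (n + n₀) W} ≠ ∞ := by
    refine ne_top_of_le_ne_top ?_ (ENNReal.tsum_le_tsum fun n => hbound (n + n₀) (by omega))
    rw [ENNReal.tsum_mul_right]
    refine ENNReal.mul_ne_top ?_ (gaussianMoment_lt_top _).ne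
    have hs : Summable fun n : ℕ => (1 / 2 : ℝ) ^ (n + n₀) :=
      (summable_nat_add_iff n₀).2 (summable_geometric_of_lt_one (by norm_num) (by norm_num))
    rw [← ENNReal.ofReal_tsum_of_nonneg (fun n => by positivity) hs]
    exact ENNReal.ofReal_ne_top
  filter_upwards [ae_eventually_notMem hsum] with W hW
  obtain ⟨N, hN⟩ := eventually_atTop.1 hW
  refine eventually_atTop.2 ⟨N + n₀, fun n hn => ?_⟩
  have := hN (n - n₀) (by omega)
  rw [Nat.sub_add_cancel (by omega)] at this
  exact not_not.1 this

end FractionalBrownian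

/-! ### The main result -/

open Filter in
lemma measurableSet_frequently_separated (α : ℝ) (y : Space 2) :
    MeasurableSet {p : SignSpace × Path0 2 1 |
      ∃ᶠ n in atTop, ∃ᶠ m in atTop, Separated α y m n p.1 p.2} := by
  simp only [frequently_atTop, ofPred_forall, ofPred_exists, ofPred_and]
  exact MeasurableSet.iInter fun _ => MeasurableSet.iUnion fun n => (MeasurableSet.const _).inter
    (MeasurableSet.iInter fun _ => MeasurableSet.iUnion fun m => (MeasurableSet.const _).inter
      (measurableSet_separated α y m n))

lemma continuous_restrictPath {d : ℕ} {T ε : ℝ≥0} (h : ε ≤ T) :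
    Continuous (restrictPath h : Path0 d T → Path0 d ε) :=
  ContinuousMap.continuous_precomp _

end

theorem corollary1p7 (α : ℝ≥0) (hα : (α : ℝ) < 1 / 2) :
    ∃ (Ω : Type) (_ : MeasurableSpace Ω) (P : Measure Ω) (_ : IsProbabilityMeasure P)
      (u : Ω → ℝ → (Space 2 →ᵇ Space 2)),
      IsRandomVelocityField 1 u ∧
      (∀ ω, ∀ t ∈ Icc (0 : ℝ) 1, holderNorm α (u ω t) ≤ 2) ∧
      (∀ β : ℝ≥0, 1 / (2 * (1 - (α : ℝ))) < (β : ℝ) → β ≤ 1 →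
        ∀ W : Path0 2 1, MemHolder β W → ∀ y : Space 2,
          ∀ᵐ ω ∂P, ∀ (ε : ℝ≥0) (hε : ε ≤ 1), 0 < ε →
            HasNonuniqueSolutions (u ω) y (restrictPath hε W)) ∧
      (∀ H : ℝ, 0 < H → H < 1 → (α : ℝ) < 1 - 1 / (2 * H) →
        ∀ ν : Measure (Path0 2 1), IsFractionalBrownianLaw H ν → ∀ y : Space 2,
          ∀ᵐ ω ∂P, ∀ (ε : ℝ≥0) (hε : ε ≤ 1), 0 < ε →
            ¬ PathByPathUniqueness (u ω) y (ν.map (restrictPath hε))) := by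
  have hα0 : (0 : ℝ) ≤ α := α.coe_nonneg
  have hα1 : α ≤ 1 := by
    have : (α : ℝ) ≤ 1 := by linarith
    exact_mod_cast this
  refine ⟨SignSpace, inferInstance, coinMeasure SignIndex, inferInstance, velocity α,
    isRandomVelocityField_velocity hα0 1, fun ω t _ => holderNorm_velocity_le hα1 ω t, ?_, ?_⟩
  · intro β hβ hβ1 W hW y
    have hβ' : 1 < 2 * (1 - (α : ℝ)) * β := by
      rwa [div_lt_iff₀ (by linarith), mul_comm] at hβ
    filter_upwards [ae_frequently_separated hα0 hα
      (eventually_regularAt_of_memHolder hβ1 hβ' hW) y] with ω hω ε hε hε0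
    exact hasNonuniqueSolutions_of_frequently_separated hα0 hω hε hε0
  · intro H hH0 hH1 hH ν hν y
    have := hν.isProbabilityMeasure
    have hH' : 1 < 2 * (1 - (α : ℝ)) * H := by
      have h1 : 1 / (2 * H) < 1 - α := by linarith
      rw [div_lt_iff₀ (by linarith)] at h1
      linarith
    have hae : ∀ᵐ W ∂ν, ∀ᵐ ω ∂coinMeasure SignIndex,
        ∃ᶠ n in Filter.atTop, ∃ᶠ m in Filter.atTop, Separated α y m n ω W := by
      filter_upwards [ae_eventually_regularAt hα0 hα hH0 hH1 hH' hν] with W hW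
      exact ae_frequently_separated hα0 hα hW y
    filter_upwards [(Measure.ae_ae_comm (measurableSet_frequently_separated (α : ℝ) y)).2 hae]
      with ω hω ε hε hε0 huniq
    have huniq' := ae_of_ae_map (continuous_restrictPath hε).measurable.aemeasurable huniq
    obtain ⟨W, hW, hWu⟩ := (hω.and huniq').exists
    obtain ⟨X₁, X₂, h₁, h₂, hne⟩ := hasNonuniqueSolutions_of_frequently_separated hα0 hW hε hε0
    exact hne (hWu.unique h₁ h₂)
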